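/- Let $s_1,s_2>1$ and $p,q,r>0$. For $a\ge 0$ define, for $x\in[0,1]$, \[ W_a(x)=\begin{cases} 1-\dfrac{2(s_1+pa)}{s_1-1+pa-2ra}\,x, & 0\le x<\frac12-\dfrac{\frac12+ra}{s_1+pa},\\[2mm] (s_1+pa)\left(x-\frac12\right)+\frac12+ra, & \frac12-\dfrac{\frac12+ra}{s_1+pa}\le x<\frac12,\\[2mm] -(s_2+qa)\left(x-\frac12\right)+\frac12+ra, & \frac12\le x<\frac12+\dfrac{\frac12+ra}{s_2+qa},\\[2mm] 1+\dfrac{2(s_2+qa)}{s_2-1+qa-2ra}\,(x-1), & \frac12+\dfrac{\frac12+ra}{s_2+qa}\le x\le 1. \end{cases} \] For all sufficiently small $a\ge 0$, $W_a$ maps $[0,1]$ into itself and has exactly one invariant probability measure $\mu_a$ that is absolutely continuous with respect to Lebesgue measure on $[0,1]$. As $a\to 0^+$, the measures $\mu_a$ converge $*$-weakly to the measure (I) $\delta_{1/2}$, if $\frac1{s_1}+\frac1{s_2}>1$; (II) $\displaystyle\frac{(qs_1+ps_2-p-q)(s_2+2)}{(qs_1+ps_2-p-q)(s_2+2)+2rs_1s_2^2}\,\mu_0+\frac{2rs_1s_2^2}{(qs_1+ps_2-p-q)(s_2+2)+2rs_1s_2^2}\,\delta_{1/2}$,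 if $\frac1{s_1}+\frac1{s_2}=1$; (III) $\mu_0$, if $\frac1{s_1}+\frac1{s_2}<1$, where $\delta_{1/2}$ is the Dirac measure at the point $1/2$. -/

import Mathlib

open MeasureTheory Filter Topology Set

/-- The `W`-like map `W_a` with slope `s₁ + p a` to the left and slope `-(s₂ + q a)` to the right of
the turning point `1/2`, and with `W_a (1/2) = 1/2 + r a`. It is given by the four affine formulas
of the branches; only its values on `[0, 1]` matter. -/
noncomputable def wMap (s₁ s₂ p q r a : ℝ) (x : ℝ) : ℝ :=
  if x < 1 / 2 - (1 / 2 + r * a) / (s₁ + p * a) then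
    1 - 2 * (s₁ + p * a) / (s₁ - 1 + p * a - 2 * r * a) * x
  else if x < 1 / 2 then
    (s₁ + p * a) * (x - 1 / 2) + 1 / 2 + r * a
  else if x < 1 / 2 + (1 / 2 + r * a) / (s₂ + q * a) then
    -(s₂ + q * a) * (x - 1 / 2) + 1 / 2 + r * a
  else
    1 + 2 * (s₂ + q * a) / (s₂ - 1 + q * a - 2 * r * a) * (x - 1)

/-- `μ` is an absolutely continuous invariant (probability) measure of the map `T` of `[0, 1]`:
it is absolutely continuous with respect to Lebesgue measure on `[0, 1]` (in particular it is
concentrated on `[0, 1]`) and it is preserved by `T`. -/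
def IsACIM (T : ℝ → ℝ) (μ : ProbabilityMeasure ℝ) : Prop :=
  (μ : Measure ℝ) ≪ volume.restrict (Icc (0 : ℝ) 1) ∧
    MeasurePreserving T (μ : Measure ℝ) (μ : Measure ℝ)

/-! ### Bounded measurable functions and their primitives -/

/-! Write `σ₁`, `-σ₂` for the inner slopes, `h` for the peak value, `θ = 1/σ₁ + 1/σ₂` and `c = 1/2 -
h/σ₁`. Both outer branches are onto `[0,1]`, so a change of variables expresses the integral of `ψ ∘
T` over `[0,t]` through the integrals of `ψ` over `[0,1]`, `[0,h]` and `[0,T t]`, the last one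
multiplied by the reciprocal slope at `t` (`integral_comp_wLike`). Iterating along the orbit of `t`
gives an absolutely convergent series and a telescoping identity (`orbitSum_comp`).

This identity has two uses. For invariant `ψ` it forces the integral over `[0,t]` to be proportional
to `t`, so invariant sets are null or conull; every absolutely continuous invariant measure is
therefore ergodic, and it is unique. For `t = h` it gives an explicit signed invariant density: a
constant `A` plus `θ` times the weighted sum of the indicators of `[0, τ n]`, where `τ` is the orbit
of the peak. Its positive and negative parts are themselves invariant, hence multiples of the
invariant probability measure, so integrals against that measure are quotients of explicit
functionals (`densityIntegral_eq`).

The limit depends on the sign of `(s₁-1)(s₂-1) - 1`, which is opposite to that of `1/s₁ + 1/s₂ - 1`.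
If it is negative, the small interval `[T h, h]` is eventually forward invariant and by ergodicity
carries all the mass (`measure_trap`). Otherwise split the functional as `A` times a step functional
plus a remainder concentrating at `1/2` (`densityIntegral_eq_add`). If the sign is positive, `A`
tends to `1 - (1/s₁ + 1/s₂) > 0` and the remainder vanishes, which leaves `μ₀`. If it is zero, `A`
and the remainder are both of order `a`, and their limits after division by `a` give the two
weights. The uniform domination needed there is `weight_bounds`. -/

/-- A measurable real function bounded by `C` in absolute value. -/
structure BddMeasurable (C : ℝ) (ψ : ℝ → ℝ) : Prop where
  measurable : Measurable ψ
  bound : ∀ x, |ψ x| ≤ C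

namespace BddMeasurable

variable {C : ℝ} {ψ T : ℝ → ℝ}

lemma nonneg (hψ : BddMeasurable C ψ) : 0 ≤ C := (abs_nonneg _).trans (hψ.bound 0)

lemma comp (hψ : BddMeasurable C ψ) (hT : Measurable T) : BddMeasurable C (fun x => ψ (T x)) :=
  ⟨hψ.measurable.comp hT, fun x => hψ.bound (T x)⟩

lemma integrable (hψ : BddMeasurable C ψ) (μ : Measure ℝ) [IsFiniteMeasure μ] : Integrable ψ μ :=
  Integrable.of_bound hψ.measurable.aestronglyMeasurable C (ae_of_all _ hψ.bound)

lemma intervalIntegrable (hψ : BddMeasurable C ψ) (a b : ℝ) : IntervalIntegrable ψ volume a b := by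
  rw [intervalIntegrable_iff]
  have : IsFiniteMeasure (volume.restrict (Set.uIoc a b)) := ⟨by simp [Set.uIoc]⟩
  exact hψ.integrable _

lemma abs_integral_le (hψ : BddMeasurable C ψ) (a b : ℝ) :
    |∫ x in a..b, ψ x| ≤ C * |b - a| := by
  simpa using intervalIntegral.norm_integral_le_of_norm_le_const (a := a) (b := b)
    (f := ψ) (C := C) (fun x _ => hψ.bound x)

lemma abs_primitive_le (hψ : BddMeasurable C ψ) {t : ℝ} (ht : t ∈ Icc (0 : ℝ) 1) :
    |∫ x in (0 : ℝ)..t, ψ x| ≤ C := by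
  refine (hψ.abs_integral_le 0 t).trans ?_
  rw [sub_zero, abs_of_nonneg ht.1]
  exact mul_le_of_le_one_right hψ.nonneg ht.2

lemma primitive_sub (hψ : BddMeasurable C ψ) (a b : ℝ) :
    (∫ x in (0 : ℝ)..b, ψ x) - ∫ x in (0 : ℝ)..a, ψ x = ∫ x in a..b, ψ x :=
  intervalIntegral.integral_interval_sub_left (hψ.intervalIntegrable _ _)
    (hψ.intervalIntegrable _ _)

lemma integral_comp_affine (hψ : BddMeasurable C ψ) {k d u v : ℝ} (hk : k ≠ 0) (huv : u ≤ v)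
    (h : ∀ x ∈ Ioo u v, T x = k * x + d) :
    ∫ x in u..v, ψ (T x) =
      k⁻¹ * ((∫ x in (0 : ℝ)..(k * v + d), ψ x) - ∫ x in (0 : ℝ)..(k * u + d), ψ x) := by
  rw [hψ.primitive_sub, ← smul_eq_mul, ← intervalIntegral.integral_comp_mul_add ψ hk]
  exact intervalIntegral.integral_congr_Ioo_of_le huv fun x hx => by simp only [h x hx]

lemma indicator {s : Set ℝ} (hs : MeasurableSet s) :
    BddMeasurable 1 (s.indicator (fun _ => (1 : ℝ))) :=
  ⟨measurable_const.indicator hs, fun x => by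
    by_cases hx : x ∈ s <;> simp [hx]⟩

lemma one : BddMeasurable 1 (fun _ => (1 : ℝ)) := ⟨measurable_const, fun _ => by simp⟩

end BddMeasurable

/-! ### The `W`-like maps -/

/-- The `W`-like map with inner slopes `σ₁` and `-σ₂`, with value `h` at the turning point `1/2`,
and with affine outer branches onto `[0, 1]`. -/
noncomputable def wLike (σ₁ σ₂ h x : ℝ) : ℝ :=
  if x < 1 / 2 - h / σ₁ then 1 - x / (1 / 2 - h / σ₁)
  else if x < 1 / 2 then h + σ₁ * (x - 1 / 2)
  else if x < 1 / 2 + h / σ₂ then h - σ₂ * (x - 1 / 2)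
  else 1 + (x - 1) / (1 / 2 - h / σ₂)

/-- The reciprocal of the slope of `wLike` at `x` (from the right at the turning points). -/
noncomputable def wLikeInvSlope (σ₁ σ₂ h x : ℝ) : ℝ :=
  if x < 1 / 2 - h / σ₁ then -(1 / 2 - h / σ₁)
  else if x < 1 / 2 then 1 / σ₁
  else if x < 1 / 2 + h / σ₂ then -(1 / σ₂)
  else 1 / 2 - h / σ₂

/-- The parameters for which `wLike` is an expanding map of `[0, 1]` with four branches and with
contraction rate at most `ρ` for the inverse branches. -/
structure WAdmissible (ρ σ₁ σ₂ h : ℝ) : Prop where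
  half_le : 1 / 2 ≤ h
  le_one : h ≤ 1
  lt₁ : 2 * h < σ₁
  lt₂ : 2 * h < σ₂
  half_le_rate : 1 / 2 ≤ ρ
  inv₁ : 1 / σ₁ ≤ ρ
  inv₂ : 1 / σ₂ ≤ ρ
  rate_lt : ρ < 1

lemma measurable_wLike (σ₁ σ₂ h : ℝ) : Measurable (wLike σ₁ σ₂ h) := by
  unfold wLike
  refine Measurable.ite measurableSet_Iio (by fun_prop) ?_
  refine Measurable.ite measurableSet_Iio (by fun_prop) ?_
  exact Measurable.ite measurableSet_Iio (by fun_prop) (by fun_prop)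

/-! ### Weighted sums along an orbit and the change of variables identity. -/

/-- The product of the reciprocal slopes along the first `n` points of the orbit of `t`. -/
noncomputable def orbitWeight (σ₁ σ₂ h t : ℝ) (n : ℕ) : ℝ :=
  ∏ i ∈ Finset.range n, wLikeInvSlope σ₁ σ₂ h ((wLike σ₁ σ₂ h)^[i] t)

/-- The indicator of `[1/2, ∞)`. -/
noncomputable def rightHalf (t : ℝ) : ℝ := if 1 / 2 ≤ t then 1 else 0

/-- The sum of the orbit weights of `t`. -/
noncomputable def weightSum (σ₁ σ₂ h t : ℝ) : ℝ := ∑' n, orbitWeight σ₁ σ₂ h t n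

/-- The sum of the orbit weights of `t` over the visits to `[1/2, 1]`. -/
noncomputable def rightSum (σ₁ σ₂ h t : ℝ) : ℝ :=
  ∑' n, orbitWeight σ₁ σ₂ h t n * rightHalf ((wLike σ₁ σ₂ h)^[n] t)

/-- The integral of `ψ` against the weighted sum of the indicators of the intervals `[0, tₙ]`,
where `tₙ` runs through the orbit of `t`. -/
noncomputable def orbitSum (σ₁ σ₂ h t : ℝ) (ψ : ℝ → ℝ) : ℝ :=
  ∑' n, orbitWeight σ₁ σ₂ h t n * ∫ x in (0 : ℝ)..(wLike σ₁ σ₂ h)^[n] t, ψ x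

namespace WAdmissible

variable {ρ σ₁ σ₂ h C t : ℝ} {ψ : ℝ → ℝ}

section basic
variable (H : WAdmissible ρ σ₁ σ₂ h)
include H

lemma pos₁ : 0 < σ₁ := by linarith [H.half_le, H.lt₁]
lemma pos₂ : 0 < σ₂ := by linarith [H.half_le, H.lt₂]
lemma rate_nonneg : 0 ≤ ρ := by linarith [H.half_le_rate]
lemma ratio₁_pos : 0 < h / σ₁ := div_pos (by linarith [H.half_le]) H.pos₁
lemma ratio₂_pos : 0 < h / σ₂ := div_pos (by linarith [H.half_le]) H.pos₂
lemma ratio₁_lt : h / σ₁ < 1 / 2 := by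
  rw [div_lt_iff₀ H.pos₁]; linarith [H.lt₁]
lemma ratio₂_lt : h / σ₂ < 1 / 2 := by
  rw [div_lt_iff₀ H.pos₂]; linarith [H.lt₂]

lemma mapsTo : MapsTo (wLike σ₁ σ₂ h) (Icc 0 1) (Icc 0 1) := by
  rintro x ⟨h0, h1⟩
  have e1 := H.ratio₁_lt
  have e2 := H.ratio₂_lt
  have p1 := H.pos₁
  have p2 := H.pos₂
  have q1 : σ₁ * (h / σ₁) = h := by field_simp
  have q2 : σ₂ * (h / σ₂) = h := by field_simp
  have hh := H.le_one
  unfold wLike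
  split_ifs with a b c
  · have : x / (1 / 2 - h / σ₁) ≤ 1 := (div_le_one (by linarith)).2 a.le
    have : 0 ≤ x / (1 / 2 - h / σ₁) := div_nonneg h0 (by linarith)
    constructor <;> linarith
  · have := mul_le_mul_of_nonneg_left (not_lt.1 a) p1.le
    have := mul_le_mul_of_nonneg_left b.le p1.le
    constructor <;> linarith
  · have := mul_le_mul_of_nonneg_left (not_lt.1 b) p2.le
    have := mul_le_mul_of_nonneg_left c.le p2.le
    constructor <;> linarith
  · have hx : (x - 1) / (1 / 2 - h / σ₂) ≤ 0 := div_nonpos_of_nonpos_of_nonneg (by linarith) (by linarith)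
    have : -1 ≤ (x - 1) / (1 / 2 - h / σ₂) := by
      rw [le_div_iff₀ (by linarith)]; linarith
    constructor <;> linarith

lemma iterate_mem (ht : t ∈ Icc (0 : ℝ) 1) (n : ℕ) : (wLike σ₁ σ₂ h)^[n] t ∈ Icc (0 : ℝ) 1 :=
  H.mapsTo.iterate n ht

lemma peak_mem : h ∈ Icc (0 : ℝ) 1 := ⟨by linarith [H.half_le], H.le_one⟩

lemma abs_invSlope_le (x : ℝ) : |wLikeInvSlope σ₁ σ₂ h x| ≤ ρ := by
  have e1 := H.ratio₁_lt
  have e2 := H.ratio₂_lt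
  have f1 := H.ratio₁_pos
  have f2 := H.ratio₂_pos
  have := H.half_le_rate
  have p1 := one_div_pos.2 H.pos₁
  have p2 := one_div_pos.2 H.pos₂
  unfold wLikeInvSlope
  split_ifs
  · rw [abs_neg, abs_of_pos] <;> linarith
  · rw [abs_of_pos p1]; exact H.inv₁
  · rw [abs_neg, abs_of_pos p2]; exact H.inv₂
  · rw [abs_of_pos] <;> linarith

lemma abs_weight_succ_le (t : ℝ) (n : ℕ) :
    |orbitWeight σ₁ σ₂ h t (n + 1)| ≤ ρ * |orbitWeight σ₁ σ₂ h t n| := by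
  unfold orbitWeight
  rw [Finset.prod_range_succ, abs_mul, mul_comm]
  exact mul_le_mul_of_nonneg_right (H.abs_invSlope_le _) (abs_nonneg _)

lemma abs_weight_le (t : ℝ) (n : ℕ) : |orbitWeight σ₁ σ₂ h t n| ≤ ρ ^ n := by
  induction n with
  | zero => simp [orbitWeight]
  | succ n ih =>
    rw [pow_succ']
    exact (H.abs_weight_succ_le t n).trans (mul_le_mul_of_nonneg_left ih H.rate_nonneg)

lemma summable_rate : Summable (fun n : ℕ => ρ ^ n) :=
  summable_geometric_of_lt_one H.rate_nonneg H.rate_lt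

lemma summable_weight_mul (t : ℝ) {c : ℕ → ℝ} {C : ℝ} (hc : ∀ n, |c n| ≤ C) :
    Summable (fun n => orbitWeight σ₁ σ₂ h t n * c n) := by
  refine Summable.of_norm_bounded (H.summable_rate.mul_right C) fun n => ?_
  rw [Real.norm_eq_abs, abs_mul]
  exact mul_le_mul (H.abs_weight_le t n) (hc n) (abs_nonneg _) (pow_nonneg H.rate_nonneg n)

lemma abs_tsum_weight_mul_le (t : ℝ) {c : ℕ → ℝ} {C : ℝ} (hc : ∀ n, |c n| ≤ C) :
    |∑' n, orbitWeight σ₁ σ₂ h t n * c n| ≤ (1 - ρ)⁻¹ * C := by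
  rw [← tsum_geometric_of_lt_one H.rate_nonneg H.rate_lt, ← tsum_mul_right, ← Real.norm_eq_abs]
  refine tsum_of_norm_bounded (H.summable_rate.mul_right C).hasSum fun n => ?_
  rw [Real.norm_eq_abs, abs_mul]
  exact mul_le_mul (H.abs_weight_le t n) (hc n) (abs_nonneg _) (pow_nonneg H.rate_nonneg n)

end basic

lemma summable_weight (H : WAdmissible ρ σ₁ σ₂ h) (t : ℝ) :
    Summable (orbitWeight σ₁ σ₂ h t) := by
  simpa using H.summable_weight_mul t (c := fun _ => 1) (C := 1) (by simp)

/-- The change of variables formula on `[0, t]`. -/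
lemma integral_comp_wLike (H : WAdmissible ρ σ₁ σ₂ h) (hψ : BddMeasurable C ψ)
    (ht : t ∈ Icc (0 : ℝ) 1) :
    ∫ x in (0 : ℝ)..t, ψ (wLike σ₁ σ₂ h x) =
      (1 / 2 - h / σ₁) * (∫ x in (0 : ℝ)..1, ψ x) +
      (1 / σ₁ + 1 / σ₂) * rightHalf t * (∫ x in (0 : ℝ)..h, ψ x) +
      wLikeInvSlope σ₁ σ₂ h t * ∫ x in (0 : ℝ)..wLike σ₁ σ₂ h t, ψ x := by
  obtain ⟨h0, h1⟩ := ht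
  have e1 := H.ratio₁_lt
  have e2 := H.ratio₂_lt
  have f1 := H.ratio₁_pos
  have f2 := H.ratio₂_pos
  have p1 := H.pos₁
  have p2 := H.pos₂
  have hT := hψ.comp (measurable_wLike σ₁ σ₂ h)
  have ii := fun a b => hT.intervalIntegrable a b
  set c := 1 / 2 - h / σ₁ with hc
  set d := 1 / 2 + h / σ₂ with hd
  have hcpos : 0 < c := by linarith
  have hdpos : 0 < 1 / 2 - h / σ₂ := by linarith
  -- One computation per branch, for integrals starting at its left end, where the branch takes the
  -- values `1`, `0`, `h`, `0` respectively. A decreasing branch contributes its whole range once it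
  -- is entered, corrected by the negative reciprocal slope times the integral up to `T t`; hence
  -- the term with `c` for every `t`, and the jump by `1/σ₁ + 1/σ₂` at `1/2`.
  have B1 : ∀ t, 0 ≤ t → t ≤ c → ∫ x in (0 : ℝ)..t, ψ (wLike σ₁ σ₂ h x) =
      c * ((∫ x in (0 : ℝ)..1, ψ x) - ∫ x in (0 : ℝ)..(1 - t / c), ψ x) := by
    intro t ht htc
    rw [hψ.integral_comp_affine (k := -c⁻¹) (d := 1) (neg_ne_zero.2 (inv_ne_zero hcpos.ne')) ht]
    · rw [inv_neg, inv_inv, mul_zero, zero_add,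
        show -c⁻¹ * t + 1 = 1 - t / c by field_simp; ring]
      ring
    · intro x hx
      have : x < c := hx.2.trans_le htc
      simp only [wLike, ← hc, this, if_true]
      field_simp; ring
  have B2 : ∀ t, c ≤ t → t ≤ 1 / 2 → ∫ x in c..t, ψ (wLike σ₁ σ₂ h x) =
      1 / σ₁ * ∫ x in (0 : ℝ)..(h + σ₁ * (t - 1 / 2)), ψ x := by
    intro t ht htc
    rw [hψ.integral_comp_affine (k := σ₁) (d := h - σ₁ / 2) p1.ne' ht]
    · rw [show σ₁ * c + (h - σ₁ / 2) = 0 by rw [hc]; field_simp; ring,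
        show σ₁ * t + (h - σ₁ / 2) = h + σ₁ * (t - 1 / 2) by ring]
      simp
    · intro x hx
      have a : ¬ x < c := not_lt.2 hx.1.le
      have b : x < 1 / 2 := hx.2.trans_le htc
      simp only [wLike, ← hc, a, b, if_true, if_false]
      ring
  have B3 : ∀ t, 1 / 2 ≤ t → t ≤ d → ∫ x in (1 / 2)..t, ψ (wLike σ₁ σ₂ h x) =
      1 / σ₂ * ((∫ x in (0 : ℝ)..h, ψ x) - ∫ x in (0 : ℝ)..(h - σ₂ * (t - 1 / 2)), ψ x) := by
    intro t ht htc
    rw [hψ.integral_comp_affine (k := -σ₂) (d := h + σ₂ / 2) (neg_ne_zero.2 p2.ne') ht]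
    · rw [show -σ₂ * (1 / 2) + (h + σ₂ / 2) = h by ring,
        show -σ₂ * t + (h + σ₂ / 2) = h - σ₂ * (t - 1 / 2) by ring, inv_neg]
      ring
    · intro x hx
      have a : ¬ x < c := by linarith [hx.1]
      have b : ¬ x < 1 / 2 := not_lt.2 hx.1.le
      have e : x < d := hx.2.trans_le htc
      simp only [wLike, ← hc, ← hd, a, b, e, if_true, if_false]
      ring
  have B4 : ∀ t, d ≤ t → ∫ x in d..t, ψ (wLike σ₁ σ₂ h x) =
      (1 / 2 - h / σ₂) * ∫ x in (0 : ℝ)..(1 + (t - 1) / (1 / 2 - h / σ₂)), ψ x := by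
    intro t ht
    set g := 1 / 2 - h / σ₂ with hg
    have hgd : g = 1 - d := by rw [hg, hd]; ring
    rw [hψ.integral_comp_affine (k := g⁻¹) (d := 1 - g⁻¹) (inv_ne_zero hdpos.ne') ht]
    · rw [show g⁻¹ * d + (1 - g⁻¹) = 0 by
          rw [show d = 1 - g by rw [hgd]; ring]; field_simp; ring,
        show g⁻¹ * t + (1 - g⁻¹) = 1 + (t - 1) / g by field_simp; ring, inv_inv]
      simp
    · intro x hx
      have a : ¬ x < c := by linarith [hx.1]
      have b : ¬ x < 1 / 2 := by linarith [hx.1]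
      have e : ¬ x < d := not_lt.2 hx.1.le
      simp only [wLike, ← hc, ← hd, ← hg, a, b, e, if_false]
      field_simp; ring
  have hcT : 1 - c / c = 0 := by rw [div_self hcpos.ne', sub_self]
  by_cases a : t < c
  · have b : ¬ (1 / 2 ≤ t) := by linarith
    rw [B1 t h0 a.le]
    simp only [wLike, wLikeInvSlope, rightHalf, ← hc, a, b, if_true, if_false]
    ring
  have S1 := B1 c hcpos.le le_rfl
  rw [hcT, intervalIntegral.integral_same, sub_zero] at S1
  by_cases b : t < 1 / 2
  · have b' : ¬ (1 / 2 ≤ t) := by linarith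
    rw [← intervalIntegral.integral_add_adjacent_intervals (ii 0 c) (ii c t), S1,
      B2 t (not_lt.1 a) b.le]
    simp only [wLike, wLikeInvSlope, rightHalf, ← hc, a, b, b', if_true, if_false]
    ring
  have S2 := B2 (1 / 2) (by linarith) le_rfl
  rw [sub_self, mul_zero, add_zero] at S2
  have b' : 1 / 2 ≤ t := not_lt.1 b
  by_cases e : t < d
  · rw [← intervalIntegral.integral_add_adjacent_intervals (ii 0 c) (ii c t),
      ← intervalIntegral.integral_add_adjacent_intervals (ii c (1 / 2)) (ii (1 / 2) t), S1, S2,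
      B3 t b' e.le]
    simp only [wLike, wLikeInvSlope, rightHalf, ← hc, ← hd, a, b, b', e, if_true, if_false]
    ring
  have S3 := B3 d (by linarith) le_rfl
  rw [show h - σ₂ * (d - 1 / 2) = 0 by rw [hd]; field_simp; ring, intervalIntegral.integral_same,
    sub_zero] at S3
  rw [← intervalIntegral.integral_add_adjacent_intervals (ii 0 c) (ii c t),
    ← intervalIntegral.integral_add_adjacent_intervals (ii c (1 / 2)) (ii (1 / 2) t),
    ← intervalIntegral.integral_add_adjacent_intervals (ii (1 / 2) d) (ii d t), S1, S2, S3,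
    B4 t (not_lt.1 e)]
  simp only [wLike, wLikeInvSlope, rightHalf, ← hc, ← hd, a, b, b', e, if_true, if_false]
  ring

/-- The change of variables formula on the whole of `[0, 1]`. -/
lemma integral_comp_wLike_one (H : WAdmissible ρ σ₁ σ₂ h) (hψ : BddMeasurable C ψ) :
    ∫ x in (0 : ℝ)..1, ψ (wLike σ₁ σ₂ h x) =
      (∫ x in (0 : ℝ)..1, ψ x) + (1 / σ₁ + 1 / σ₂) *
        ((∫ x in (0 : ℝ)..h, ψ x) - h * ∫ x in (0 : ℝ)..1, ψ x) := by
  have e1 := H.ratio₁_pos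
  have e2 := H.ratio₂_lt
  have a : ¬ (1 : ℝ) < 1 / 2 - h / σ₁ := by linarith
  have b : ¬ (1 : ℝ) < 1 / 2 := by norm_num
  have b' : (1 / 2 : ℝ) ≤ 1 := by norm_num
  have c : ¬ (1 : ℝ) < 1 / 2 + h / σ₂ := by linarith
  rw [H.integral_comp_wLike hψ (by simp)]
  simp only [wLike, wLikeInvSlope, rightHalf, a, b, c, b', if_true, if_false, sub_self, zero_div,
    add_zero]
  ring

lemma abs_rightHalf_le (t : ℝ) : |rightHalf t| ≤ 1 := by
  unfold rightHalf; split_ifs <;> simp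

lemma summable_orbitSum (H : WAdmissible ρ σ₁ σ₂ h) (hψ : BddMeasurable C ψ)
    (ht : t ∈ Icc (0 : ℝ) 1) :
    Summable fun n => orbitWeight σ₁ σ₂ h t n * ∫ x in (0 : ℝ)..(wLike σ₁ σ₂ h)^[n] t, ψ x :=
  H.summable_weight_mul t fun n => hψ.abs_primitive_le (H.iterate_mem ht n)

/-- Apply the change of variables at every point of the orbit, multiply by its weight and sum. The
boundary term at the `n`-th point is exactly the `(n+1)`-st term of `orbitSum`, so only the term of
index `0` is lost. -/
lemma orbitSum_comp (H : WAdmissible ρ σ₁ σ₂ h) (hψ : BddMeasurable C ψ)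
    (ht : t ∈ Icc (0 : ℝ) 1) :
    orbitSum σ₁ σ₂ h t (fun x => ψ (wLike σ₁ σ₂ h x)) =
      (1 / 2 - h / σ₁) * weightSum σ₁ σ₂ h t * (∫ x in (0 : ℝ)..1, ψ x) +
      (1 / σ₁ + 1 / σ₂) * rightSum σ₁ σ₂ h t * (∫ x in (0 : ℝ)..h, ψ x) +
      (orbitSum σ₁ σ₂ h t ψ - ∫ x in (0 : ℝ)..t, ψ x) := by
  have s := H.summable_orbitSum hψ ht
  have e : orbitSum σ₁ σ₂ h t ψ - (∫ x in (0 : ℝ)..t, ψ x) =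
      ∑' n, orbitWeight σ₁ σ₂ h t (n + 1) *
        ∫ x in (0 : ℝ)..(wLike σ₁ σ₂ h)^[n + 1] t, ψ x := by
    unfold orbitSum
    rw [s.tsum_eq_zero_add]
    simp [orbitWeight]
  have s' := (summable_nat_add_iff 1).2 s
  rw [e]
  unfold weightSum rightSum orbitSum
  rw [mul_comm (1 / 2 - h / σ₁), mul_comm (1 / σ₁ + 1 / σ₂), mul_assoc, mul_assoc, ← tsum_mul_right,
    ← tsum_mul_right]
  have s1 := (H.summable_weight t).mul_right ((1 / 2 - h / σ₁) * ∫ x in (0 : ℝ)..1, ψ x)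
  have s2 := (H.summable_weight_mul t (fun n => abs_rightHalf_le ((wLike σ₁ σ₂ h)^[n] t))).mul_right
    ((1 / σ₁ + 1 / σ₂) * ∫ x in (0 : ℝ)..h, ψ x)
  rw [← s1.tsum_add s2, ← (s1.add s2).tsum_add s']
  refine tsum_congr fun n => ?_
  rw [H.integral_comp_wLike hψ (H.iterate_mem ht n), Function.iterate_succ_apply']
  have : orbitWeight σ₁ σ₂ h t (n + 1) =
      orbitWeight σ₁ σ₂ h t n * wLikeInvSlope σ₁ σ₂ h ((wLike σ₁ σ₂ h)^[n] t) :=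
    Finset.prod_range_succ _ _
  rw [this]
  ring

/-- The length of `[0, t]` in terms of the orbit of `t`. -/
lemma eq_sums (H : WAdmissible ρ σ₁ σ₂ h) (ht : t ∈ Icc (0 : ℝ) 1) :
    t = (1 / 2 - h / σ₁) * weightSum σ₁ σ₂ h t +
      (1 / σ₁ + 1 / σ₂) * rightSum σ₁ σ₂ h t * h := by
  have := H.orbitSum_comp BddMeasurable.one ht
  simp only [intervalIntegral.integral_const, sub_zero, smul_eq_mul, mul_one] at this
  linarith

/-- For a function `ψ` that is invariant under the map, the average over `[0, t]` does not depend on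
`t`. -/
lemma primitive_eq_of_invariant (H : WAdmissible ρ σ₁ σ₂ h) (hψ : BddMeasurable C ψ)
    (hinv : ∀ x, ψ (wLike σ₁ σ₂ h x) = ψ x) (ht : t ∈ Icc (0 : ℝ) 1) :
    ∫ x in (0 : ℝ)..t, ψ x = t * ∫ x in (0 : ℝ)..1, ψ x := by
  have e := H.orbitSum_comp hψ ht
  have e1 := H.integral_comp_wLike_one hψ
  simp only [hinv] at e e1
  have hθ : 0 < 1 / σ₁ + 1 / σ₂ := add_pos (one_div_pos.2 H.pos₁) (one_div_pos.2 H.pos₂)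
  -- The formula over the whole of `[0,1]` has the same integral on both sides, so the term with the
  -- positive factor `1/σ₁ + 1/σ₂` must vanish.
  have e2 : (∫ x in (0 : ℝ)..h, ψ x) = h * ∫ x in (0 : ℝ)..1, ψ x := by
    have : (1 / σ₁ + 1 / σ₂) *
        ((∫ x in (0 : ℝ)..h, ψ x) - h * ∫ x in (0 : ℝ)..1, ψ x) = 0 := by linarith
    have := (mul_eq_zero.1 this).resolve_left hθ.ne'
    linarith
  have e3 := H.eq_sums ht
  rw [e2] at e
  calc _ = ((1 / 2 - h / σ₁) * weightSum σ₁ σ₂ h t +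
      (1 / σ₁ + 1 / σ₂) * rightSum σ₁ σ₂ h t * h) * ∫ x in (0 : ℝ)..1, ψ x := by linarith
    _ = _ := by rw [← e3]

end WAdmissible

/-! ### Invariant sets, ergodicity and uniqueness. -/

lemma setIntegral_Icc_indicator_Iic {g : ℝ → ℝ} {t : ℝ} (ht : t ∈ Icc (0 : ℝ) 1) :
    ∫ x in Icc (0 : ℝ) 1, (Iic t).indicator g x = ∫ x in (0 : ℝ)..t, g x := by
  rw [setIntegral_indicator measurableSet_Iic, intervalIntegral.integral_of_le ht.1,
    ← integral_Icc_eq_integral_Ioc]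
  congr 2
  ext x
  simp only [mem_inter_iff, mem_Icc, mem_Iic]
  exact ⟨fun h => ⟨h.1.1, h.2⟩, fun h => ⟨⟨h.1, h.2.trans ht.2⟩, h.2⟩⟩

lemma setIntegral_Icc_zero_one {g : ℝ → ℝ} :
    ∫ x in Icc (0 : ℝ) 1, g x = ∫ x in (0 : ℝ)..1, g x := by
  rw [intervalIntegral.integral_of_le zero_le_one, integral_Icc_eq_integral_Ioc]

/-- If the intersection of a set with `[0, t]` has a length proportional to `t`, then the set has
measure zero or full measure in `[0, 1]`. -/
lemma null_or_conull_of_proportional {s : Set ℝ} (hs : MeasurableSet s)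
    (h : ∀ t ∈ Icc (0 : ℝ) 1, ∫ x in (0 : ℝ)..t, s.indicator (fun _ => (1 : ℝ)) x =
      t * ∫ x in (0 : ℝ)..1, s.indicator (fun _ => (1 : ℝ)) x) :
    volume.restrict (Icc (0 : ℝ) 1) s = 0 ∨ volume.restrict (Icc (0 : ℝ) 1) sᶜ = 0 := by
  set l : Measure ℝ := volume.restrict (Icc (0 : ℝ) 1) with hl
  have : IsProbabilityMeasure l := ⟨by simp [hl]⟩
  have hprim : ∀ t ∈ Icc (0 : ℝ) 1, ∫ x in (0 : ℝ)..t, s.indicator (fun _ => (1 : ℝ)) x =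
      l.real (Iic t ∩ s) := by
    intro t ht
    rw [← setIntegral_Icc_indicator_Iic ht, indicator_indicator,
      integral_indicator (measurableSet_Iic.inter hs)]
    simp [hl]
  have hl1 : l.real (Iic 1 ∩ s) = l.real s := by
    have : (Iic (1 : ℝ) ∩ s : Set ℝ) =ᵐ[l] s := by
      filter_upwards [ae_restrict_mem measurableSet_Icc] with x hx
      exact propext ⟨fun h => h.2, fun h => ⟨hx.2, h⟩⟩
    exact measureReal_congr this
  have hIic : ∀ t ∈ Icc (0 : ℝ) 1, l (Iic t) = ENNReal.ofReal t := by
    intro t ht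
    rw [hl, Measure.restrict_apply measurableSet_Iic]
    have : Iic t ∩ Icc 0 1 = Icc 0 t := by
      ext x; simp only [mem_inter_iff, mem_Icc, mem_Iic]
      exact ⟨fun h => ⟨h.2.1, h.1⟩, fun h => ⟨h.2, h.1, h.2.trans ht.2⟩⟩
    rw [this]; simp
  -- Proportionality on initial segments makes the two measures equal; evaluating both at the
  -- complement of `s` yields `l s * l sᶜ = 0`.
  have key : l.restrict s = (l s) • l := by
    refine Measure.ext_of_Iic _ _ fun t => ?_
    have main : ∀ t ∈ Icc (0 : ℝ) 1, l.restrict s (Iic t) = ((l s) • l) (Iic t) := by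
      intro t ht
      have e := h t ht
      rw [hprim t ht, hprim 1 (by simp), hl1] at e
      rw [Measure.restrict_apply measurableSet_Iic, Measure.smul_apply, hIic t ht, smul_eq_mul,
        ← ENNReal.ofReal_toReal (measure_ne_top l (Iic t ∩ s)), ← Measure.real, e,
        ENNReal.ofReal_mul ht.1, Measure.real, ENNReal.ofReal_toReal (measure_ne_top l s), mul_comm]
    rcases lt_or_ge t 0 with h0 | h0
    · have : l (Iic t) = 0 := by
        rw [hl, Measure.restrict_apply measurableSet_Iic]
        convert measure_empty (μ := (volume : Measure ℝ))
        ext x; simp only [mem_inter_iff, mem_Icc, mem_Iic, mem_empty_iff_false, iff_false]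
        intro h; linarith [h.1, h.2.1]
      rw [Measure.smul_apply, this, smul_zero]
      exact le_antisymm ((Measure.restrict_apply_le _ _).trans this.le) bot_le
    rcases le_or_gt t 1 with h1 | h1
    · exact main t ⟨h0, h1⟩
    · have : ∀ ν : Measure ℝ, ν ≪ l → ν (Iic t) = ν (Iic 1) := by
        intro ν hν
        refine measure_congr ?_
        filter_upwards [hν.ae_le (ae_restrict_mem measurableSet_Icc)] with x hx
        simp only [eq_iff_iff]
        exact ⟨fun _ => hx.2, fun _ => hx.2.trans h1.le⟩
      rw [this _ Measure.absolutelyContinuous_restrict, this _ (Measure.smul_absolutelyContinuous)]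
      exact main 1 (by simp)
  have e : l.restrict s sᶜ = 0 := by
    rw [Measure.restrict_apply hs.compl, compl_inter_self, measure_empty]
  rw [key, Measure.smul_apply, smul_eq_mul, mul_eq_zero] at e
  exact e

/-- The positive part of a signed invariant density is an invariant density. -/
lemma measurePreserving_withDensity_of_invariant {α : Type*} [MeasurableSpace α] {l : Measure α}
    {T : α → α} (hT : Measurable T) {g : α → ℝ} (hgm : Measurable g) (hg : Integrable g l)
    (hinv : ∀ B, MeasurableSet B → ∫ x in T ⁻¹' B, g x ∂l = ∫ x in B, g x ∂l) :
    MeasurePreserving T (l.withDensity fun x => ENNReal.ofReal (g x))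
      (l.withDensity fun x => ENNReal.ofReal (g x)) := by
  set E : Set α := {x | 0 < g x} with hE
  have hEm : MeasurableSet E := measurableSet_lt measurable_const hgm
  -- Among all sets, the set where `g > 0` makes the integral of `g` largest. Invariance gives its
  -- preimage the same integral, so the two indicators times `g` agree almost everywhere.
  have hle : ∀ x, (T ⁻¹' E).indicator g x ≤ E.indicator g x := by
    intro x
    by_cases h1 : x ∈ E
    · by_cases h2 : x ∈ T ⁻¹' E
      · simp [h1, h2]
      · rw [indicator_of_notMem h2, indicator_of_mem h1]; exact le_of_lt h1
    · by_cases h2 : x ∈ T ⁻¹' E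
      · rw [indicator_of_notMem h1, indicator_of_mem h2]; exact not_lt.1 h1
      · simp [h1, h2]
  have hae : (T ⁻¹' E).indicator g =ᵐ[l] E.indicator g := by
    have h0 : 0 ≤ᵐ[l] fun x => E.indicator g x - (T ⁻¹' E).indicator g x :=
      ae_of_all _ fun x => sub_nonneg.2 (hle x)
    have hi : Integrable (fun x => E.indicator g x - (T ⁻¹' E).indicator g x) l :=
      (hg.indicator hEm).sub (hg.indicator (hT hEm))
    have hz : ∫ x, E.indicator g x - (T ⁻¹' E).indicator g x ∂l = 0 := by
      rw [integral_sub (hg.indicator hEm) (hg.indicator (hT hEm)), integral_indicator hEm,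
        integral_indicator (hT hEm), hinv E hEm, sub_self]
    filter_upwards [(integral_eq_zero_iff_of_nonneg_ae h0 hi).1 hz] with x hx
    simp only [Pi.zero_apply] at hx
    linarith
  have hval : ∀ B, MeasurableSet B → (l.withDensity fun x => ENNReal.ofReal (g x)) B =
      ENNReal.ofReal (∫ x in B, E.indicator g x ∂l) := by
    intro B hB
    rw [withDensity_apply _ hB, ofReal_integral_eq_lintegral_ofReal
      ((hg.indicator hEm).integrableOn)]
    · refine lintegral_congr fun x => ?_
      by_cases h1 : x ∈ E
      · rw [indicator_of_mem h1]
      · rw [indicator_of_notMem h1, ENNReal.ofReal_zero]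
        exact ENNReal.ofReal_of_nonpos (not_lt.1 h1)
    · refine ae_of_all _ fun x => ?_
      by_cases h1 : x ∈ E
      · rw [indicator_of_mem h1]; exact le_of_lt h1
      · rw [indicator_of_notMem h1]; rfl
  refine ⟨hT, Measure.ext fun B hB => ?_⟩
  rw [Measure.map_apply hT hB, hval _ (hT hB), hval B hB]
  congr 1
  rw [setIntegral_congr_ae (g := (T ⁻¹' E).indicator g) (hT hB)
    (by filter_upwards [hae] with x hx _ using hx.symm), setIntegral_indicator (hT hEm),
    setIntegral_indicator hEm, ← preimage_inter, hinv _ (hB.inter hEm)]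

/-- A measurable set that is invariant under a `W`-like map has measure zero or full measure in
`[0, 1]`. -/
lemma WAdmissible.null_or_conull {ρ σ₁ σ₂ h : ℝ} (H : WAdmissible ρ σ₁ σ₂ h) {s : Set ℝ}
    (hs : MeasurableSet s) (hinv : wLike σ₁ σ₂ h ⁻¹' s = s) :
    volume.restrict (Icc (0 : ℝ) 1) s = 0 ∨ volume.restrict (Icc (0 : ℝ) 1) sᶜ = 0 := by
  refine null_or_conull_of_proportional hs fun t ht =>
    H.primitive_eq_of_invariant (BddMeasurable.indicator hs) (fun x => ?_) ht
  have : wLike σ₁ σ₂ h x ∈ s ↔ x ∈ s := by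
    rw [← mem_preimage, hinv]
  by_cases hx : x ∈ s
  · simp [hx, this.2 hx]
  · rw [indicator_of_notMem hx, indicator_of_notMem (mt this.1 hx)]

lemma WAdmissible.ergodic {ρ σ₁ σ₂ h : ℝ} (H : WAdmissible ρ σ₁ σ₂ h) {m : Measure ℝ}
    (hm : m ≪ volume.restrict (Icc (0 : ℝ) 1)) (hp : MeasurePreserving (wLike σ₁ σ₂ h) m m) :
    Ergodic (wLike σ₁ σ₂ h) m := by
  refine ⟨hp, ⟨fun s hs hinv => ?_⟩⟩
  rw [eventuallyConst_set']
  rcases H.null_or_conull hs hinv with h0 | h0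
  · exact Or.inl (ae_eq_empty.2 (hm h0))
  · exact Or.inr (ae_eq_univ.2 (hm h0))

/-- The sum `μ + ν` is again absolutely continuous and invariant, hence ergodic. Both summands are
dominated by it, so each is a constant multiple of it; comparing total masses finds the ratio. -/
lemma WAdmissible.measure_eq {ρ σ₁ σ₂ h : ℝ} (H : WAdmissible ρ σ₁ σ₂ h) {μ ν : Measure ℝ}
    [IsProbabilityMeasure μ] [IsFiniteMeasure ν]
    (hμ : μ ≪ volume.restrict (Icc (0 : ℝ) 1)) (hμp : MeasurePreserving (wLike σ₁ σ₂ h) μ μ)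
    (hν : ν ≪ volume.restrict (Icc (0 : ℝ) 1)) (hνp : MeasurePreserving (wLike σ₁ σ₂ h) ν ν) :
    ν = (ν univ) • μ := by
  have hT := measurable_wLike σ₁ σ₂ h
  have hsum : MeasurePreserving (wLike σ₁ σ₂ h) (μ + ν) (μ + ν) :=
    ⟨hT, by rw [Measure.map_add _ _ hT, hμp.map_eq, hνp.map_eq]⟩
  have hac : μ + ν ≪ volume.restrict (Icc (0 : ℝ) 1) := fun s hs => by
    rw [Measure.add_apply, hμ hs, hν hs, add_zero]
  have he := H.ergodic hac hsum
  obtain ⟨c, hc⟩ := he.eq_smul_of_absolutelyContinuous hμp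
    (Measure.absolutelyContinuous_of_le (Measure.le_add_right le_rfl))
  obtain ⟨d, hd⟩ := he.eq_smul_of_absolutelyContinuous hνp
    (Measure.absolutelyContinuous_of_le (Measure.le_add_left le_rfl))
  have h1 := congrArg (fun m : Measure ℝ => m univ) hc
  have h2 := congrArg (fun m : Measure ℝ => m univ) hd
  simp only [Measure.smul_apply, Measure.add_apply, measure_univ, smul_eq_mul] at h1 h2
  have hdc : d = ν univ * c := by
    calc d = d * (c * (1 + ν univ)) := by rw [← h1, mul_one]
      _ = c * (d * (1 + ν univ)) := by ring
      _ = ν univ * c := by rw [← h2, mul_comm]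
  calc ν = d • (μ + ν) := hd
    _ = ν univ • c • (μ + ν) := by rw [hdc, smul_smul]
    _ = ν univ • μ := by rw [← hc]

/-! ### The signed invariant density and existence of the invariant measure. -/

/-- The constant term of the signed invariant density of `wLike`. -/
noncomputable def densityConst (σ₁ σ₂ h : ℝ) : ℝ :=
  1 - (1 / σ₁ + 1 / σ₂) * rightSum σ₁ σ₂ h h

/-- A signed invariant density of `wLike`, normalized by its value at the turning point. -/
noncomputable def signedDensity (σ₁ σ₂ h x : ℝ) : ℝ :=
  densityConst σ₁ σ₂ h + (1 / σ₁ + 1 / σ₂) *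
    ∑' n, orbitWeight σ₁ σ₂ h h n * (Iic ((wLike σ₁ σ₂ h)^[n] h)).indicator (fun _ => (1 : ℝ)) x

/-- The integral against the signed invariant density. -/
noncomputable def densityIntegral (σ₁ σ₂ h : ℝ) (ψ : ℝ → ℝ) : ℝ :=
  densityConst σ₁ σ₂ h * (∫ x in (0 : ℝ)..1, ψ x) + (1 / σ₁ + 1 / σ₂) * orbitSum σ₁ σ₂ h h ψ

namespace WAdmissible

variable {ρ σ₁ σ₂ h C t : ℝ} {ψ : ℝ → ℝ}

lemma const_mul_peak (H : WAdmissible ρ σ₁ σ₂ h) :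
    densityConst σ₁ σ₂ h * h = (1 / 2 - h / σ₁) * weightSum σ₁ σ₂ h h := by
  have := H.eq_sums H.peak_mem
  unfold densityConst
  linarith

/-- Two cancellations occur. The terms in the integral over `[0,h]` cancel by the choice `1 - θ R`
of `densityConst`, with `R` the `rightSum` of the peak, and those in the integral over `[0,1]`
cancel by `const_mul_peak`. -/
lemma densityIntegral_comp (H : WAdmissible ρ σ₁ σ₂ h) (hψ : BddMeasurable C ψ) :
    densityIntegral σ₁ σ₂ h (fun x => ψ (wLike σ₁ σ₂ h x)) = densityIntegral σ₁ σ₂ h ψ := by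
  have e := H.const_mul_peak
  unfold densityIntegral
  rw [H.orbitSum_comp hψ H.peak_mem, H.integral_comp_wLike_one hψ]
  have : (1 / σ₁ + 1 / σ₂) * rightSum σ₁ σ₂ h h = 1 - densityConst σ₁ σ₂ h := by
    unfold densityConst; ring
  rw [this, ← e]
  ring

lemma abs_indicator_le (s : Set ℝ) (x : ℝ) : |s.indicator (fun _ => (1 : ℝ)) x| ≤ 1 := by
  by_cases hx : x ∈ s <;> simp [hx]

lemma summable_signedDensity (H : WAdmissible ρ σ₁ σ₂ h) (x : ℝ) :
    Summable fun n => orbitWeight σ₁ σ₂ h h n *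
      (Iic ((wLike σ₁ σ₂ h)^[n] h)).indicator (fun _ => (1 : ℝ)) x :=
  H.summable_weight_mul h fun _ => abs_indicator_le _ _

lemma bddMeasurable_signedDensity (H : WAdmissible ρ σ₁ σ₂ h) :
    ∃ C, BddMeasurable C (signedDensity σ₁ σ₂ h) := by
  refine ⟨|densityConst σ₁ σ₂ h| + |1 / σ₁ + 1 / σ₂| * ((1 - ρ)⁻¹ * 1), ?_, fun x => ?_⟩
  · refine measurable_const.add (measurable_const.mul ?_)
    refine measurable_of_tendsto_metrizable (f := fun (n : ℕ) x => ∑ i ∈ Finset.range n,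
      orbitWeight σ₁ σ₂ h h i *
        (Iic ((wLike σ₁ σ₂ h)^[i] h)).indicator (fun _ => (1 : ℝ)) x) (fun n => ?_) ?_
    · exact Finset.measurable_sum _ fun i _ =>
        measurable_const.mul (measurable_const.indicator measurableSet_Iic)
    · rw [tendsto_pi_nhds]
      exact fun x => (H.summable_signedDensity x).hasSum.tendsto_sum_nat
  · refine (abs_add_le _ _).trans (add_le_add_right ?_ _)
    rw [abs_mul]
    exact mul_le_mul_of_nonneg_left (H.abs_tsum_weight_mul_le h fun _ => abs_indicator_le _ _)
      (abs_nonneg _)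

lemma integral_mul_signedDensity (H : WAdmissible ρ σ₁ σ₂ h) (hψ : BddMeasurable C ψ) :
    ∫ x in Icc (0 : ℝ) 1, ψ x * signedDensity σ₁ σ₂ h x = densityIntegral σ₁ σ₂ h ψ := by
  set τ : ℕ → ℝ := fun n => (wLike σ₁ σ₂ h)^[n] h with hτ
  set l : Measure ℝ := volume.restrict (Icc (0 : ℝ) 1) with hl
  have hint : ∀ n, ∫ x in Icc (0 : ℝ) 1,
      orbitWeight σ₁ σ₂ h h n * (Iic (τ n)).indicator ψ x =
      orbitWeight σ₁ σ₂ h h n * ∫ x in (0 : ℝ)..τ n, ψ x := fun n => by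
    rw [integral_const_mul, setIntegral_Icc_indicator_Iic (H.iterate_mem H.peak_mem n)]
  have hψi := hψ.integrable l
  have hI : ∀ n, Integrable (fun x => orbitWeight σ₁ σ₂ h h n * (Iic (τ n)).indicator ψ x) l :=
    fun n => (hψi.indicator measurableSet_Iic).const_mul _
  have hb : ∀ n x, ‖orbitWeight σ₁ σ₂ h h n * (Iic (τ n)).indicator ψ x‖ ≤ ρ ^ n * C := by
    intro n x
    rw [norm_mul]
    refine mul_le_mul (H.abs_weight_le h n) ?_ (norm_nonneg _) (pow_nonneg H.rate_nonneg n)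
    exact (norm_indicator_le_norm_self _ _).trans (hψ.bound x)
  have hs : HasSum (fun n => ∫ x, orbitWeight σ₁ σ₂ h h n * (Iic (τ n)).indicator ψ x ∂l)
      (∫ x, ∑' n, orbitWeight σ₁ σ₂ h h n * (Iic (τ n)).indicator ψ x ∂l) := by
    refine hasSum_integral_of_dominated_convergence (fun n _ => ρ ^ n * C)
      (fun n => (hI n).aestronglyMeasurable) (fun n => ae_of_all _ (hb n))
      (ae_of_all _ fun _ => H.summable_rate.mul_right C) (integrable_const _)
      (ae_of_all _ fun x => ?_)
    exact (Summable.of_norm_bounded (H.summable_rate.mul_right C) fun n => hb n x).hasSum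
  have hsI : Integrable
      (fun x => ∑' n, orbitWeight σ₁ σ₂ h h n * (Iic (τ n)).indicator ψ x) l := by
    refine Integrable.of_bound ?_ (∑' n, ρ ^ n * C) (ae_of_all _ fun x =>
      tsum_of_norm_bounded (H.summable_rate.mul_right C).hasSum fun n => hb n x)
    refine Measurable.aestronglyMeasurable ?_
    refine measurable_of_tendsto_metrizable (f := fun (n : ℕ) x => ∑ i ∈ Finset.range n,
      orbitWeight σ₁ σ₂ h h i * (Iic (τ i)).indicator ψ x) (fun n => ?_) ?_
    · exact Finset.measurable_sum _ fun i _ =>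
        measurable_const.mul (hψ.measurable.indicator measurableSet_Iic)
    · rw [tendsto_pi_nhds]
      exact fun x => (Summable.of_norm_bounded (H.summable_rate.mul_right C)
        fun n => hb n x).hasSum.tendsto_sum_nat
  have hfun : ∀ x, ψ x * signedDensity σ₁ σ₂ h x = densityConst σ₁ σ₂ h * ψ x +
      (1 / σ₁ + 1 / σ₂) * ∑' n, orbitWeight σ₁ σ₂ h h n * (Iic (τ n)).indicator ψ x := by
    intro x
    unfold signedDensity
    rw [mul_add, mul_comm, mul_left_comm, ← tsum_mul_left]
    congr 2
    refine tsum_congr fun n => ?_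
    by_cases hx : x ∈ Iic (τ n)
    · rw [indicator_of_mem hx, indicator_of_mem hx]; ring
    · rw [indicator_of_notMem hx, indicator_of_notMem hx]; ring
  simp only [hfun]
  rw [integral_add (hψi.const_mul _) (hsI.const_mul _), integral_const_mul, integral_const_mul,
    ← hs.tsum_eq, setIntegral_Icc_zero_one]
  simp only [hl, hint]
  rfl

lemma setIntegral_signedDensity (H : WAdmissible ρ σ₁ σ₂ h) {B : Set ℝ} (hB : MeasurableSet B) :
    ∫ x in B, signedDensity σ₁ σ₂ h x ∂(volume.restrict (Icc (0 : ℝ) 1)) =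
      densityIntegral σ₁ σ₂ h (B.indicator fun _ => 1) := by
  rw [← H.integral_mul_signedDensity (BddMeasurable.indicator hB), ← integral_indicator hB]
  congr 1
  ext x
  by_cases hx : x ∈ B <;> simp [hx]

lemma setIntegral_preimage_signedDensity (H : WAdmissible ρ σ₁ σ₂ h) {B : Set ℝ}
    (hB : MeasurableSet B) :
    ∫ x in wLike σ₁ σ₂ h ⁻¹' B, signedDensity σ₁ σ₂ h x ∂(volume.restrict (Icc (0 : ℝ) 1)) =
      ∫ x in B, signedDensity σ₁ σ₂ h x ∂(volume.restrict (Icc (0 : ℝ) 1)) := by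
  rw [H.setIntegral_signedDensity hB,
    H.setIntegral_signedDensity (measurable_wLike σ₁ σ₂ h hB),
    ← H.densityIntegral_comp (BddMeasurable.indicator hB)]
  rfl

/-- At `1/2` the indicator of `(-∞, τ n]` equals `rightHalf (τ n)`, so the series becomes
`rightSum`, which the constant term compensates. -/
lemma _root_.signedDensity_half (σ₁ σ₂ h : ℝ) : signedDensity σ₁ σ₂ h (1 / 2) = 1 := by
  have : (∑' n, orbitWeight σ₁ σ₂ h h n *
      (Iic ((wLike σ₁ σ₂ h)^[n] h)).indicator (fun _ => (1 : ℝ)) (1 / 2)) =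
      rightSum σ₁ σ₂ h h := by
    refine tsum_congr fun n => ?_
    simp only [rightHalf, indicator, mem_Iic]
  unfold signedDensity densityConst
  rw [this]
  ring

/-- Indicators of closed half-lines `(-∞, τ]` are left-continuous, and the geometric majorant passes
this to the series. With the value `1` at `1/2` it makes the density positive on an interval, so its
positive part is a nonzero measure. -/
lemma tendsto_signedDensity (H : WAdmissible ρ σ₁ σ₂ h) :
    Tendsto (signedDensity σ₁ σ₂ h) (𝓝[<] (1 / 2)) (𝓝 1) := by
  have half := signedDensity_half σ₁ σ₂ h
  rw [show 𝓝 (1 : ℝ) = 𝓝 (signedDensity σ₁ σ₂ h (1 / 2)) by rw [half]]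
  refine tendsto_const_nhds.add (tendsto_const_nhds.mul ?_)
  refine tendsto_tsum_of_dominated_convergence H.summable_rate (fun n => ?_)
    (Eventually.of_forall fun x n => ?_)
  · refine tendsto_const_nhds.mul (tendsto_const_nhds.congr' ?_)
    rcases le_or_gt (1 / 2) ((wLike σ₁ σ₂ h)^[n] h) with hn | hn
    · filter_upwards [self_mem_nhdsWithin] with x hx
      rw [indicator_of_mem (mem_Iic.2 hn), indicator_of_mem (mem_Iic.2 ((mem_Iio.1 hx).le.trans hn))]
    · filter_upwards [Ioo_mem_nhdsLT hn] with x hx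
      rw [indicator_of_notMem (by simpa using hn),
        indicator_of_notMem (by simpa using hx.1)]
  · rw [norm_mul]
    exact (mul_le_mul (H.abs_weight_le h n) (abs_indicator_le _ _) (abs_nonneg _)
      (pow_nonneg H.rate_nonneg n)).trans (mul_one _).le

/-- The positive part of the signed invariant density is an invariant measure. -/
lemma positivePart (H : WAdmissible ρ σ₁ σ₂ h) :
    MeasurePreserving (wLike σ₁ σ₂ h)
      ((volume.restrict (Icc (0 : ℝ) 1)).withDensity
        fun x => ENNReal.ofReal (signedDensity σ₁ σ₂ h x))
      ((volume.restrict (Icc (0 : ℝ) 1)).withDensity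
        fun x => ENNReal.ofReal (signedDensity σ₁ σ₂ h x)) := by
  obtain ⟨C, hC⟩ := H.bddMeasurable_signedDensity
  exact measurePreserving_withDensity_of_invariant (measurable_wLike σ₁ σ₂ h) hC.measurable
    (hC.integrable _) fun B hB => H.setIntegral_preimage_signedDensity hB

lemma negativePart (H : WAdmissible ρ σ₁ σ₂ h) :
    MeasurePreserving (wLike σ₁ σ₂ h)
      ((volume.restrict (Icc (0 : ℝ) 1)).withDensity
        fun x => ENNReal.ofReal (-signedDensity σ₁ σ₂ h x))
      ((volume.restrict (Icc (0 : ℝ) 1)).withDensity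
        fun x => ENNReal.ofReal (-signedDensity σ₁ σ₂ h x)) := by
  obtain ⟨C, hC⟩ := H.bddMeasurable_signedDensity
  refine measurePreserving_withDensity_of_invariant (measurable_wLike σ₁ σ₂ h) hC.measurable.neg
    (hC.integrable _).neg fun B hB => ?_
  rw [integral_neg, integral_neg, H.setIntegral_preimage_signedDensity hB]

lemma _root_.BddMeasurable.isFiniteMeasure_withDensity {g : ℝ → ℝ} (hg : BddMeasurable C g) :
    IsFiniteMeasure ((volume.restrict (Icc (0 : ℝ) 1)).withDensity
      fun x => ENNReal.ofReal (g x)) :=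
  isFiniteMeasure_withDensity_ofReal (hg.integrable _).2

lemma exists_isACIM (H : WAdmissible ρ σ₁ σ₂ h) :
    ∃ ν : ProbabilityMeasure ℝ, IsACIM (wLike σ₁ σ₂ h) ν := by
  obtain ⟨C, hC⟩ := H.bddMeasurable_signedDensity
  have hfin := hC.isFiniteMeasure_withDensity
  have hpos := H.positivePart
  have hac := withDensity_absolutelyContinuous (volume.restrict (Icc (0 : ℝ) 1))
    (fun x => ENNReal.ofReal (signedDensity σ₁ σ₂ h x))
  have hne : ((volume.restrict (Icc (0 : ℝ) 1)).withDensity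
      fun x => ENNReal.ofReal (signedDensity σ₁ σ₂ h x)) univ ≠ 0 := by
    intro h0
    rw [withDensity_apply _ MeasurableSet.univ, Measure.restrict_univ,
      lintegral_eq_zero_iff hC.measurable.ennreal_ofReal, EventuallyEq,
      ae_restrict_iff' measurableSet_Icc] at h0
    have h1 : ∀ᶠ x in 𝓝[<] (1 / 2 : ℝ), 0 < signedDensity σ₁ σ₂ h x :=
      H.tendsto_signedDensity.eventually (lt_mem_nhds one_pos)
    obtain ⟨a, ha, ha'⟩ := (mem_nhdsLT_iff_exists_Ioo_subset).1
      (h1.and (Ioo_mem_nhdsLT (show (0 : ℝ) < 1 / 2 by norm_num)))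
    have : volume (Ioo a (1 / 2)) = 0 := by
      refine measure_mono_null (fun x hx => ?_) h0
      obtain ⟨k1, k2⟩ := ha' hx
      simp only [mem_compl_iff, mem_ofPred_eq, not_forall, Pi.zero_apply]
      exact ⟨⟨k2.1.le, by linarith [k2.2]⟩, (ENNReal.ofReal_pos.2 k1).ne'⟩
    rw [Real.volume_Ioo, ENNReal.ofReal_eq_zero] at this
    linarith [mem_Iio.1 ha]
  set ν := (volume.restrict (Icc (0 : ℝ) 1)).withDensity
      fun x => ENNReal.ofReal (signedDensity σ₁ σ₂ h x) with hν
  have hprob : IsProbabilityMeasure ((ν univ)⁻¹ • ν) :=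
    ⟨by rw [Measure.smul_apply, smul_eq_mul, ENNReal.inv_mul_cancel hne (measure_ne_top _ _)]⟩
  refine ⟨⟨(ν univ)⁻¹ • ν, hprob⟩, Measure.AbsolutelyContinuous.smul_left hac _, ?_⟩
  exact ⟨hpos.measurable, by
    show Measure.map _ ((ν univ)⁻¹ • ν) = (ν univ)⁻¹ • ν
    rw [Measure.map_smul, hpos.map_eq]⟩

lemma existsUnique_isACIM (H : WAdmissible ρ σ₁ σ₂ h) :
    ∃! ν : ProbabilityMeasure ℝ, IsACIM (wLike σ₁ σ₂ h) ν := by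
  obtain ⟨ν, hν⟩ := H.exists_isACIM
  refine ⟨ν, hν, fun μ hμ => ?_⟩
  have := H.measure_eq hν.1 hν.2 hμ.1 hμ.2
  rw [measure_univ, one_smul] at this
  exact Subtype.ext this

/-- The integral against the signed invariant density is proportional to the integral with respect
to the absolutely continuous invariant measure. -/
lemma densityIntegral_eq (H : WAdmissible ρ σ₁ σ₂ h) {μ : ProbabilityMeasure ℝ}
    (hμ : IsACIM (wLike σ₁ σ₂ h) μ) (hψ : BddMeasurable C ψ) :
    densityIntegral σ₁ σ₂ h ψ = densityIntegral σ₁ σ₂ h (fun _ => 1) * ∫ x, ψ x ∂(μ : Measure ℝ) := by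
  obtain ⟨D, hD⟩ := H.bddMeasurable_signedDensity
  have hD' : BddMeasurable D (fun x => -signedDensity σ₁ σ₂ h x) :=
    ⟨hD.measurable.neg, fun x => by rw [abs_neg]; exact hD.bound x⟩
  have := hD.isFiniteMeasure_withDensity
  have := hD'.isFiniteMeasure_withDensity
  have e1 := H.measure_eq hμ.1 hμ.2 (withDensity_absolutelyContinuous _ _) H.positivePart
  have e2 := H.measure_eq hμ.1 hμ.2 (withDensity_absolutelyContinuous _ _) H.negativePart
  set l : Measure ℝ := volume.restrict (Icc (0 : ℝ) 1) with hl
  set c₁ := (l.withDensity fun x => ENNReal.ofReal (signedDensity σ₁ σ₂ h x)) univ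
  set c₂ := (l.withDensity fun x => ENNReal.ofReal (-signedDensity σ₁ σ₂ h x)) univ
  -- By uniqueness the positive and negative parts have masses `c₁` and `c₂` times `μ`. Their
  -- difference is the signed density; `ψ = 1` then identifies the factor `c₁ - c₂`, which may a
  -- priori vanish.
  have key : ∀ {C : ℝ} {ψ : ℝ → ℝ}, BddMeasurable C ψ → densityIntegral σ₁ σ₂ h ψ =
      (c₁.toReal - c₂.toReal) * ∫ x, ψ x ∂(μ : Measure ℝ) := by
    intro C ψ hψ
    have i1 : ∀ {g : ℝ → ℝ}, BddMeasurable D g →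
        ∫ x, ψ x ∂(l.withDensity fun x => ENNReal.ofReal (g x)) =
        ∫ x, ψ x * max (g x) 0 ∂l := by
      intro g hg
      rw [integral_withDensity_eq_integral_toReal_smul hg.measurable.ennreal_ofReal
        (ae_of_all _ fun _ => ENNReal.ofReal_lt_top)]
      simp only [ENNReal.toReal_ofReal', smul_eq_mul, mul_comm]
    have i2 : ∀ {g : ℝ → ℝ}, BddMeasurable D g → Integrable (fun x => ψ x * max (g x) 0) l := by
      intro g hg
      have hm : BddMeasurable D (fun x => max (g x) 0) :=
        ⟨hg.measurable.max measurable_const, fun x => by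
          rw [abs_of_nonneg (le_max_right _ _)]
          exact max_le ((le_abs_self _).trans (hg.bound x)) hg.nonneg⟩
      refine BddMeasurable.integrable (C := C * D) ⟨hψ.measurable.mul hm.measurable, fun x => ?_⟩ l
      rw [Pi.mul_apply, abs_mul]
      exact mul_le_mul (hψ.bound x) (hm.bound x) (abs_nonneg _) hψ.nonneg
    have j1 := i1 hD
    have j2 := i1 hD'
    rw [e1, integral_smul_measure, smul_eq_mul] at j1
    rw [e2, integral_smul_measure, smul_eq_mul] at j2
    rw [← H.integral_mul_signedDensity hψ, sub_mul, j1, j2, ← integral_sub (i2 hD) (i2 hD')]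
    refine integral_congr_ae (ae_of_all _ fun x => ?_)
    simp only
    rw [← mul_sub]
    congr 1
    rcases le_total (signedDensity σ₁ σ₂ h x) 0 with h0 | h0
    · rw [max_eq_right h0, max_eq_left (by linarith)]; ring
    · rw [max_eq_left h0, max_eq_right (by linarith)]; ring
  rw [key hψ, key BddMeasurable.one]
  simp

end WAdmissible

/-! ### Bounds on the orbit of the peak, and the trapping interval. -/

lemma orbitWeight_succ (σ₁ σ₂ h t : ℝ) (n : ℕ) :
    orbitWeight σ₁ σ₂ h t (n + 1) =
      orbitWeight σ₁ σ₂ h t n * wLikeInvSlope σ₁ σ₂ h ((wLike σ₁ σ₂ h)^[n] t) :=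
  Finset.prod_range_succ _ _

lemma orbitWeight_zero (σ₁ σ₂ h t : ℝ) : orbitWeight σ₁ σ₂ h t 0 = 1 := Finset.prod_range_zero _

section branches

variable {σ₁ σ₂ h x : ℝ}

lemma wLike_of_left (h1 : 1 / 2 - h / σ₁ ≤ x) (h2 : x < 1 / 2) :
    wLike σ₁ σ₂ h x = h + σ₁ * (x - 1 / 2) := by
  simp only [wLike, not_lt.2 h1, h2, if_true, if_false]

lemma wLikeInvSlope_of_left (h1 : 1 / 2 - h / σ₁ ≤ x) (h2 : x < 1 / 2) :
    wLikeInvSlope σ₁ σ₂ h x = 1 / σ₁ := by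
  simp only [wLikeInvSlope, not_lt.2 h1, h2, if_true, if_false]

end branches

namespace WAdmissible

variable {ρ σ₁ σ₂ h C x : ℝ} {ψ : ℝ → ℝ}

lemma wLike_of_right (H : WAdmissible ρ σ₁ σ₂ h) (h1 : 1 / 2 ≤ x) (h2 : x < 1 / 2 + h / σ₂) :
    wLike σ₁ σ₂ h x = h - σ₂ * (x - 1 / 2) := by
  have a : ¬ x < 1 / 2 - h / σ₁ := by linarith [H.ratio₁_pos]
  simp only [wLike, a, not_lt.2 h1, h2, if_true, if_false]

lemma wLikeInvSlope_of_right (H : WAdmissible ρ σ₁ σ₂ h) (h1 : 1 / 2 ≤ x)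
    (h2 : x < 1 / 2 + h / σ₂) : wLikeInvSlope σ₁ σ₂ h x = -(1 / σ₂) := by
  have a : ¬ x < 1 / 2 - h / σ₁ := by linarith [H.ratio₁_pos]
  simp only [wLikeInvSlope, a, not_lt.2 h1, h2, if_true, if_false]

/-- Centring each primitive at `1/2` splits off the total weight, which `const_mul_peak` turns into
a multiple of `densityConst`. The remaining series is small when the relevant part of the orbit is
near `1/2`. -/
lemma densityIntegral_eq_add (H : WAdmissible ρ σ₁ σ₂ h) (hψ : BddMeasurable C ψ) :
    densityIntegral σ₁ σ₂ h ψ =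
      densityConst σ₁ σ₂ h * ((∫ x in (0 : ℝ)..1, ψ x) +
        (1 / σ₁ + 1 / σ₂) * (h / (1 / 2 - h / σ₁)) * ∫ x in (0 : ℝ)..(1 / 2), ψ x) +
      (1 / σ₁ + 1 / σ₂) * ∑' n, orbitWeight σ₁ σ₂ h h n *
        ((∫ x in (0 : ℝ)..(wLike σ₁ σ₂ h)^[n] h, ψ x) - ∫ x in (0 : ℝ)..(1 / 2), ψ x) := by
  have hc : 1 / 2 - h / σ₁ ≠ 0 := by linarith [H.ratio₁_lt]
  have e : weightSum σ₁ σ₂ h h = densityConst σ₁ σ₂ h * (h / (1 / 2 - h / σ₁)) := by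
    rw [← mul_div_assoc, H.const_mul_peak, mul_div_cancel_left₀ _ hc]
  simp only [mul_sub]
  rw [(H.summable_orbitSum hψ H.peak_mem).tsum_sub ((H.summable_weight h).mul_right _),
    tsum_mul_right]
  change _ = _ + _ * (orbitSum σ₁ σ₂ h h ψ - weightSum σ₁ σ₂ h h * _)
  rw [e]
  unfold densityIntegral
  ring

lemma rightSum_eq_one_add (H : WAdmissible ρ σ₁ σ₂ h) :
    rightSum σ₁ σ₂ h h = 1 + ∑' n, orbitWeight σ₁ σ₂ h h (n + 1) *
      rightHalf ((wLike σ₁ σ₂ h)^[n + 1] h) := by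
  unfold rightSum
  rw [(H.summable_weight_mul h fun n => abs_rightHalf_le _).tsum_eq_zero_add]
  simp [orbitWeight_zero, rightHalf, show (2 : ℝ)⁻¹ ≤ h by linarith [H.half_le]]

/-- When the orbit of the turning point is repelled slowly along the increasing inner branch, its
weights are small compared with its distance to the turning point. -/
lemma weight_bounds (H : WAdmissible ρ σ₁ σ₂ h) {ε δ η M : ℝ} (hh : h = 1 / 2 + ε)
    (hε : 0 < ε) (hε₂ : ε < h / σ₂)
    (hδ : δ = ε * (σ₁ * σ₂ - σ₁ - σ₂) / (σ₁ - 1)) (hδpos : 0 < δ) (hη : 0 < η) (hδη : δ ≤ η)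
    (hleft : ε / (σ₁ - 1) + η ≤ h / σ₁) (hM : 0 ≤ M) (hM₁ : ε / (σ₁ - 1) ≤ M)
    (hM₂ : η * δ ≤ M ^ 2) (hM₃ : σ₁ * δ / η ≤ M ^ 2) (n : ℕ) :
    |orbitWeight σ₁ σ₂ h h (n + 1)| * rightHalf ((wLike σ₁ σ₂ h)^[n + 1] h) ≤ M * √ρ ^ n ∧
    |orbitWeight σ₁ σ₂ h h (n + 1)| * |(wLike σ₁ σ₂ h)^[n + 1] h - 1 / 2| ≤ 2 * M * √ρ ^ n := by
  have p1 := H.pos₁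
  have p2 := H.pos₂
  have l1 : 1 < σ₁ := by linarith [H.half_le, H.lt₁]
  have l2 : 1 < σ₂ := by linarith [H.half_le, H.lt₂]
  have l1' : 0 < σ₁ - 1 := by linarith
  have hq : 0 < ε / (σ₁ - 1) := div_pos hε l1'
  -- The increasing inner branch has the repelling fixed point `1/2 - ε/(σ₁-1)`, and `T h` lies at
  -- distance `δ` to its left. While this distance, `δ σ₁ ^ n`, is at most `η`, the orbit stays on
  -- that branch and its weight is explicit. When it exceeds `η`, the factor `σ₁⁻ⁿ` has already
  -- brought the weight down to `σ₁ δ / η`, and later weights only decrease in absolute value.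
  have dich : ∀ n : ℕ, ((wLike σ₁ σ₂ h)^[n + 1] h = 1 / 2 - ε / (σ₁ - 1) - δ * σ₁ ^ n ∧
      δ * σ₁ ^ n ≤ η ∧ |orbitWeight σ₁ σ₂ h h (n + 1)| = 1 / σ₂ * (1 / σ₁) ^ n) ∨
      |orbitWeight σ₁ σ₂ h h (n + 1)| ≤ σ₁ * δ / η := by
    intro n
    induction n with
    | zero =>
      left
      have a : h < 1 / 2 + h / σ₂ := by linarith
      refine ⟨?_, by simpa using hδη, ?_⟩
      · simp only [zero_add, Function.iterate_one, pow_zero, mul_one]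
        rw [H.wLike_of_right H.half_le a, hδ, hh]
        field_simp
        ring
      · rw [orbitWeight_succ, orbitWeight_zero, one_mul, Function.iterate_zero, id,
          H.wLikeInvSlope_of_right H.half_le a, abs_neg, pow_zero, mul_one,
          abs_of_pos (one_div_pos.2 p2)]
    | succ n ih =>
      have hsucc : |orbitWeight σ₁ σ₂ h h (n + 1 + 1)| ≤ |orbitWeight σ₁ σ₂ h h (n + 1)| :=
        (H.abs_weight_succ_le h (n + 1)).trans
          (mul_le_of_le_one_left (abs_nonneg _) H.rate_lt.le)
      rcases ih with ⟨e1, e2, e3⟩ | ih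
      · rcases le_or_gt (δ * σ₁ ^ (n + 1)) η with hn | hn
        · left
          have hpos : 0 < δ * σ₁ ^ n := by positivity
          have a1 : 1 / 2 - h / σ₁ ≤ (wLike σ₁ σ₂ h)^[n + 1] h := by rw [e1]; linarith
          have a2 : (wLike σ₁ σ₂ h)^[n + 1] h < 1 / 2 := by rw [e1]; linarith
          refine ⟨?_, hn, ?_⟩
          · rw [Function.iterate_succ_apply', wLike_of_left a1 a2, e1, hh]
            field_simp
            ring
          · rw [orbitWeight_succ, wLikeInvSlope_of_left a1 a2, abs_mul, e3,
              abs_of_pos (one_div_pos.2 p1), pow_succ]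
            ring
        · right
          refine hsucc.trans ?_
          rw [e3, le_div_iff₀ hη]
          have : 1 / σ₂ * (1 / σ₁) ^ n ≤ (1 / σ₁) ^ n := by
            refine mul_le_of_le_one_left (by positivity) ?_
            rw [div_le_one p2]; exact l2.le
          calc 1 / σ₂ * (1 / σ₁) ^ n * η ≤ (1 / σ₁) ^ n * (δ * σ₁ ^ (n + 1)) :=
                mul_le_mul this hn.le hη.le (by positivity)
            _ = σ₁ * δ := by
                rw [one_div, inv_pow, pow_succ]; field_simp
      · right
        exact hsucc.trans ih
  have hρ0 := H.rate_nonneg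
  have hsq : ∀ n : ℕ, (√ρ ^ n) ^ 2 = ρ ^ n := fun n => by
    rw [← pow_mul, mul_comm, pow_mul, Real.sq_sqrt hρ0]
  have hρn : ρ ^ n ≤ √ρ ^ n := by
    refine pow_le_pow_left₀ hρ0 ?_ n
    exact Real.le_sqrt_of_sq_le (by nlinarith [H.rate_lt])
  have hMn : 0 ≤ M * √ρ ^ n := by positivity
  have hz : |orbitWeight σ₁ σ₂ h h (n + 1)| ≤ ρ ^ n :=
    (H.abs_weight_le h (n + 1)).trans (pow_le_pow_of_le_one hρ0 H.rate_lt.le (Nat.le_succ n))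
  rcases dich n with ⟨e1, e2, e3⟩ | hbad
  · have hpos : 0 < δ * σ₁ ^ n := by positivity
    have hlt : ¬ 1 / 2 ≤ (wLike σ₁ σ₂ h)^[n + 1] h := by rw [e1]; linarith
    constructor
    · simp only [rightHalf, hlt, if_false, mul_zero]; exact hMn
    · have hδn : δ ≤ M * √ρ ^ n := by
        refine le_of_abs_le (abs_le_of_sq_le_sq ?_ hMn)
        rw [mul_pow, hsq]
        have : (1 / σ₁) ^ n ≤ ρ ^ n := pow_le_pow_left₀ (by positivity) H.inv₁ n
        have hδ' : δ ≤ η * (1 / σ₁) ^ n := by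
          rw [one_div, inv_pow, ← div_eq_mul_inv, le_div_iff₀ (by positivity)]; exact e2
        calc δ ^ 2 = δ * δ := sq δ
          _ ≤ δ * (η * (1 / σ₁) ^ n) := mul_le_mul_of_nonneg_left hδ' hδpos.le
          _ = (η * δ) * (1 / σ₁) ^ n := by ring
          _ ≤ M ^ 2 * ρ ^ n := mul_le_mul hM₂ this (by positivity) (by positivity)
      have habs : |(wLike σ₁ σ₂ h)^[n + 1] h - 1 / 2| = ε / (σ₁ - 1) + δ * σ₁ ^ n := by
        rw [e1, abs_of_neg] <;> linarith
      have h1 : |orbitWeight σ₁ σ₂ h h (n + 1)| * (ε / (σ₁ - 1)) ≤ M * √ρ ^ n := by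
        rw [mul_comm]
        exact mul_le_mul hM₁ (hz.trans hρn) (abs_nonneg _) hM
      have h2 : |orbitWeight σ₁ σ₂ h h (n + 1)| * (δ * σ₁ ^ n) ≤ M * √ρ ^ n := by
        have : 1 / σ₂ * (1 / σ₁) ^ n * (δ * σ₁ ^ n) = 1 / σ₂ * δ := by
          rw [one_div σ₁, inv_pow]; field_simp
        rw [e3, this]
        refine le_trans (mul_le_of_le_one_left hδpos.le ?_) hδn
        rw [div_le_one p2]; exact l2.le
      rw [habs, mul_add]
      linarith
  -- After escape, the geometric mean of the bounds `M ^ 2` and `ρ ^ n` for the weight is again `M *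
  -- √ρ ^ n`.
  · have hw : |orbitWeight σ₁ σ₂ h h (n + 1)| ≤ M * √ρ ^ n := by
      refine le_of_abs_le (abs_le_of_sq_le_sq ?_ hMn)
      rw [mul_pow, hsq, sq]
      exact mul_le_mul (hbad.trans hM₃) hz (abs_nonneg _) (by positivity)
    constructor
    · refine le_trans (mul_le_of_le_one_right (abs_nonneg _) ?_) hw
      exact (le_abs_self _).trans (abs_rightHalf_le _)
    · have hm := H.iterate_mem H.peak_mem (n + 1)
      refine le_trans (mul_le_of_le_one_right (abs_nonneg _) ?_) (hw.trans (by linarith))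
      rw [abs_le]
      constructor <;> linarith [hm.1, hm.2]

/-- If the interval between the first two iterates of the turning point is forward invariant, then
it carries the absolutely continuous invariant measure. -/
lemma measure_trap (H : WAdmissible ρ σ₁ σ₂ h) {ε : ℝ} (hh : h = 1 / 2 + ε)
    (hε : 0 < ε) (hε₂ : ε < h / σ₂) (hε₁ : ε * (σ₂ - 1) ≤ h / σ₁)
    (hσ : (σ₁ - 1) * (σ₂ - 1) ≤ 1) {μ : ProbabilityMeasure ℝ}
    (hμ : IsACIM (wLike σ₁ σ₂ h) μ) :
    ∀ᵐ x ∂(μ : Measure ℝ), x ∈ Icc (1 / 2 - ε * (σ₂ - 1)) (1 / 2 + ε) := by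
  set K : Set ℝ := Icc (1 / 2 - ε * (σ₂ - 1)) (1 / 2 + ε) with hK
  set T := wLike σ₁ σ₂ h with hT
  have hTm : Measurable T := measurable_wLike σ₁ σ₂ h
  have p1 := H.pos₁
  have p2 := H.pos₂
  have l1 : 1 < σ₁ := by linarith [H.half_le, H.lt₁]
  have l2 : 1 < σ₂ := by linarith [H.half_le, H.lt₂]
  have hpos : 0 < ε * (σ₂ - 1) := mul_pos hε (by linarith)
  have htrap : MapsTo T K K := by
    rintro x ⟨hx1, hx2⟩
    rcases lt_or_ge x (1 / 2) with hx | hx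
    · rw [hT, wLike_of_left (by linarith) hx, hh]
      have a1 := mul_le_mul_of_nonneg_left hx1 p1.le
      have a2 := mul_le_mul_of_nonneg_left hx.le p1.le
      -- The lower endpoint `T h` is mapped back into `K` precisely because `(σ₁-1)(σ₂-1) ≤ 1`, that
      -- is, because it is not to the left of the repelling fixed point.
      have a3 := mul_le_mul_of_nonneg_left hσ hε.le
      constructor <;> nlinarith
    · rw [hT, H.wLike_of_right hx (by linarith), hh]
      have a1 := mul_le_mul_of_nonneg_left hx2 p2.le
      have a2 := mul_le_mul_of_nonneg_left hx p2.le
      constructor <;> nlinarith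
  set E : Set ℝ := ⋃ n : ℕ, T^[n] ⁻¹' K with hE
  have hmono : Monotone fun n : ℕ => T^[n] ⁻¹' K := by
    refine monotone_nat_of_le_succ fun n x hx => ?_
    show T^[n + 1] x ∈ K
    rw [Function.iterate_succ_apply']
    exact htrap hx
  have hKm : MeasurableSet K := measurableSet_Icc
  have hEm : MeasurableSet E := MeasurableSet.iUnion fun n => hTm.iterate n hKm
  have hinv : T ⁻¹' E = E := by
    ext x
    simp only [hE, mem_preimage, mem_iUnion]
    constructor
    · rintro ⟨n, hn⟩
      exact ⟨n + 1, by rwa [Function.iterate_succ_apply]⟩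
    · rintro ⟨n, hn⟩
      refine ⟨n, ?_⟩
      rw [← Function.iterate_succ_apply]
      exact hmono (Nat.le_succ n) hn
  have hKE : K ⊆ E := subset_iUnion (fun n : ℕ => T^[n] ⁻¹' K) 0
  have hne : volume.restrict (Icc (0 : ℝ) 1) E ≠ 0 := by
    intro h0
    have h1 : volume.restrict (Icc (0 : ℝ) 1) (Ioo (1 / 2) (1 / 2 + ε)) = 0 :=
      measure_mono_null
        (fun x hx => hKE ⟨by linarith [hx.1], hx.2.le⟩) h0
    have hsub : Ioo (1 / 2) (1 / 2 + ε) ⊆ Icc 0 1 := fun x hx =>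
      ⟨by linarith [hx.1], by linarith [hx.2, H.le_one]⟩
    rw [Measure.restrict_apply measurableSet_Ioo, inter_eq_left.2 hsub, Real.volume_Ioo,
      ENNReal.ofReal_eq_zero] at h1
    linarith
  have hEc := (H.null_or_conull hEm hinv).resolve_left hne
  have hμE : (μ : Measure ℝ) E = 1 := by
    rw [← prob_compl_eq_zero_iff hEm]; exact hμ.1 hEc
  -- The increasing preimages of `K` all have the measure of `K`, so their union, which has full
  -- measure by ergodicity, has that measure too.
  have hconst : ∀ n : ℕ, (μ : Measure ℝ) (T^[n] ⁻¹' K) = (μ : Measure ℝ) K := fun n =>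
    (hμ.2.iterate n).measure_preimage hKm.nullMeasurableSet
  have hsup : (μ : Measure ℝ) E = (μ : Measure ℝ) K := by
    rw [hE, hmono.measure_iUnion]
    simp [hconst]
  rw [hμE] at hsup
  exact (prob_compl_eq_zero_iff hKm).2 hsup.symm

end WAdmissible

/-! ### The family as `a` tends to `0`: first-order asymptotics of the orbit. -/

section family

variable {s₁ s₂ p q r : ℝ}

lemma wMap_eq_wLike {ρ a : ℝ} (H : WAdmissible ρ (s₁ + p * a) (s₂ + q * a) (1 / 2 + r * a)) :
    wMap s₁ s₂ p q r a = wLike (s₁ + p * a) (s₂ + q * a) (1 / 2 + r * a) := by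
  funext x
  have p1 := H.pos₁
  have p2 := H.pos₂
  have key : ∀ σ h y : ℝ, 0 < σ → 2 * h < σ → 2 * σ / (σ - 2 * h) * y = y / (1 / 2 - h / σ) := by
    intro σ h y hσ hlt
    have h1 : σ - 2 * h ≠ 0 := by linarith
    have : 1 / 2 - h / σ = (σ - 2 * h) / (2 * σ) := by field_simp
    rw [this]
    field_simp
  have e1 := fun y => key _ _ y p1 H.lt₁
  have e2 := fun y => key _ _ y p2 H.lt₂
  rw [show s₁ + p * a - 2 * (1 / 2 + r * a) = s₁ - 1 + p * a - 2 * r * a by ring] at e1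
  rw [show s₂ + q * a - 2 * (1 / 2 + r * a) = s₂ - 1 + q * a - 2 * r * a by ring] at e2
  unfold wMap wLike
  rw [e1, e2]
  congr 2
  · ring
  · congr 1
    ring

lemma tendsto_affine (c d : ℝ) (l : Filter ℝ) (hl : l ≤ 𝓝 0) :
    Tendsto (fun a : ℝ => c + d * a) l (𝓝 c) :=
  ((show Continuous fun a : ℝ => c + d * a by fun_prop).tendsto' 0 c (by simp)).mono_left hl

lemma tendsto_one_div_affine {c : ℝ} (hc : c ≠ 0) (d : ℝ) (l : Filter ℝ) (hl : l ≤ 𝓝 0) :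
    Tendsto (fun a : ℝ => 1 / (c + d * a)) l (𝓝 (1 / c)) :=
  tendsto_const_nhds.div (tendsto_affine c d l hl) hc

/-- A bound for the contraction rate of the inverse branches, uniform in the family. -/
noncomputable def familyRate (s₁ s₂ : ℝ) : ℝ := max (1 / 2) (max (1 / s₁) (1 / s₂))

lemma eventually_wAdmissible (hs₁ : 1 < s₁) (hs₂ : 1 < s₂) (hp : 0 < p) (hq : 0 < q) (hr : 0 < r) :
    ∀ᶠ a in 𝓝[≥] (0 : ℝ),
      WAdmissible (familyRate s₁ s₂) (s₁ + p * a) (s₂ + q * a) (1 / 2 + r * a) := by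
  have hl : 𝓝[≥] (0 : ℝ) ≤ 𝓝 0 := nhdsWithin_le_nhds
  -- `1 < s₁ + (p - 2r) a` is the condition `2h < σ₁` for `h = 1/2 + r a`; likewise on the right.
  have t1 := (tendsto_affine s₁ (p - 2 * r) _ hl).eventually (lt_mem_nhds hs₁)
  have t2 := (tendsto_affine s₂ (q - 2 * r) _ hl).eventually (lt_mem_nhds hs₂)
  have t3 := (tendsto_affine (1 / 2) r _ hl).eventually
    (gt_mem_nhds (show (1 / 2 : ℝ) < 1 by norm_num))
  filter_upwards [t1, t2, t3, self_mem_nhdsWithin] with a h1 h2 h3 h4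
  rw [mem_Ici] at h4
  have hpa := mul_nonneg hp.le h4
  have hqa := mul_nonneg hq.le h4
  have hra := mul_nonneg hr.le h4
  refine ⟨by linarith, h3.le, by linarith, by linarith, le_max_left _ _, ?_, ?_, ?_⟩
  · refine le_trans ?_ ((le_max_left _ _).trans (le_max_right _ _))
    exact one_div_le_one_div_of_le (by linarith) (by linarith)
  · refine le_trans ?_ ((le_max_right _ _).trans (le_max_right _ _))
    exact one_div_le_one_div_of_le (by linarith) (by linarith)
  · refine max_lt (by norm_num) (max_lt ?_ ?_)
    · rw [div_lt_one] <;> linarith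
    · rw [div_lt_one] <;> linarith

lemma tendsto_zero_of_tendsto_div {u : ℝ → ℝ} {v : ℝ}
    (h : Tendsto (fun a => u a / a) (𝓝[>] 0) (𝓝 v)) : Tendsto u (𝓝[>] 0) (𝓝 0) := by
  have h0 : Tendsto (fun a : ℝ => a) (𝓝[>] 0) (𝓝 0) := nhdsWithin_le_nhds
  have := h.mul h0
  rw [mul_zero] at this
  refine this.congr' ?_
  filter_upwards [self_mem_nhdsWithin] with a ha
  exact div_mul_cancel₀ _ (ne_of_gt ha)

/-- The asymptotic behaviour of the orbit of the turning point and of its weights. -/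
lemma tendsto_orbit (hs₁ : 1 < s₁) (hs₂ : 1 < s₂) (hp : 0 < p) (hq : 0 < q) (hr : 0 < r)
    (hσ : 1 ≤ (s₁ - 1) * (s₂ - 1)) (n : ℕ) :
    ∃ v : ℝ, v ≤ -(r / (s₁ - 1)) ∧ ((s₁ - 1) * (s₂ - 1) = 1 → v = -(r / (s₁ - 1))) ∧
      Tendsto (fun a => ((wLike (s₁ + p * a) (s₂ + q * a) (1 / 2 + r * a))^[n + 1] (1 / 2 + r * a) -
        1 / 2) / a) (𝓝[>] 0) (𝓝 v) ∧
      Tendsto (fun a => orbitWeight (s₁ + p * a) (s₂ + q * a) (1 / 2 + r * a) (1 / 2 + r * a)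
        (n + 1)) (𝓝[>] 0) (𝓝 (-(1 / s₂ * (1 / s₁) ^ n))) := by
  have hl : 𝓝[>] (0 : ℝ) ≤ 𝓝 0 := nhdsWithin_le_nhds
  have hadm := (eventually_wAdmissible hs₁ hs₂ hp hq hr).filter_mono
    (nhdsWithin_mono 0 Ioi_subset_Ici_self)
  have t1 := tendsto_affine s₁ p _ hl
  have t2 := tendsto_affine s₂ q _ hl
  have th := tendsto_affine (1 / 2) r _ hl
  have hs1 : 0 < s₁ - 1 := by linarith
  have hs1' : s₁ ≠ 0 := by linarith
  have hs2' : s₂ ≠ 0 := by linarith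
  induction n with
  | zero =>
    have hright : ∀ᶠ a in 𝓝[>] (0 : ℝ), 1 / 2 + r * a < 1 / 2 + (1 / 2 + r * a) / (s₂ + q * a) := by
      refine th.eventually_lt (tendsto_const_nhds.add (th.div t2 hs2')) ?_
      have : 0 < 1 / 2 / s₂ := by positivity
      linarith
    -- `T h = 1/2 - (σ₂ - 1) r a`, from the decreasing inner branch.
    refine ⟨-((s₂ - 1) * r), ?_, fun h => ?_, ?_, ?_⟩
    · rw [neg_le_neg_iff, div_le_iff₀ hs1]; nlinarith
    · rw [neg_inj, eq_div_iff hs1.ne']; linear_combination r * h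
    · have := ((t2.sub_const 1).mul_const r).neg
      refine this.congr' ?_
      filter_upwards [hadm, hright, self_mem_nhdsWithin] with a H ha ha0
      have : a ≠ 0 := ne_of_gt ha0
      rw [zero_add, Function.iterate_one, H.wLike_of_right H.half_le ha]
      field_simp
      ring
    · rw [pow_zero, mul_one]
      refine (tendsto_one_div_affine hs2' q _ hl).neg.congr' ?_
      filter_upwards [hadm, hright] with a H ha
      rw [orbitWeight_succ, orbitWeight_zero, one_mul, Function.iterate_zero, id,
        H.wLikeInvSlope_of_right H.half_le ha]
  | succ n ih =>
    obtain ⟨v, hv, hv', hu, hw⟩ := ih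
    have hu0 := tendsto_zero_of_tendsto_div hu
    have hvneg : v < 0 := hv.trans_lt (neg_neg_of_pos (div_pos hr hs1))
    have hneg : ∀ᶠ a in 𝓝[>] (0 : ℝ), (wLike (s₁ + p * a) (s₂ + q * a) (1 / 2 + r * a))^[n + 1]
        (1 / 2 + r * a) < 1 / 2 := by
      filter_upwards [hu.eventually (gt_mem_nhds hvneg), self_mem_nhdsWithin] with a ha ha0
      rw [div_lt_iff₀ ha0, zero_mul] at ha
      linarith
    have hge : ∀ᶠ a in 𝓝[>] (0 : ℝ), 1 / 2 - (1 / 2 + r * a) / (s₁ + p * a) ≤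
        (wLike (s₁ + p * a) (s₂ + q * a) (1 / 2 + r * a))^[n + 1] (1 / 2 + r * a) := by
      have : ∀ᶠ a in 𝓝[>] (0 : ℝ), -((1 / 2 + r * a) / (s₁ + p * a)) <
          (wLike (s₁ + p * a) (s₂ + q * a) (1 / 2 + r * a))^[n + 1] (1 / 2 + r * a) - 1 / 2 := by
        refine (th.div t1 hs1').neg.eventually_lt hu0 ?_
        have : 0 < 1 / 2 / s₁ := by positivity
        linarith
      filter_upwards [this] with a ha
      linarith
    -- To first order the increasing branch acts by `v ↦ r + s₁ v`, whose fixed point is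
    -- `-r/(s₁-1)`; the half-line below it is preserved.
    refine ⟨r + s₁ * v, ?_, fun h => ?_, ?_, ?_⟩
    · have := mul_le_mul_of_nonneg_left hv (show 0 ≤ s₁ by linarith)
      have e : r + s₁ * -(r / (s₁ - 1)) = -(r / (s₁ - 1)) := by field_simp; ring
      linarith
    · rw [hv' h]; field_simp; ring
    · refine ((t1.mul hu).const_add r).congr' ?_
      filter_upwards [hneg, hge, self_mem_nhdsWithin] with a h1 h2 ha0
      have : a ≠ 0 := ne_of_gt ha0
      rw [Function.iterate_succ_apply' _ (n + 1), wLike_of_left h2 h1]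
      field_simp
      ring
    · have e : -(1 / s₂ * (1 / s₁) ^ (n + 1)) = -(1 / s₂ * (1 / s₁) ^ n) * (1 / s₁) := by ring
      rw [e]
      refine (hw.mul (tendsto_one_div_affine hs1' p _ hl)).congr' ?_
      filter_upwards [hneg, hge] with a h1 h2
      rw [orbitWeight_succ _ _ _ _ (n + 1), wLikeInvSlope_of_left h2 h1]

lemma eventually_rightHalf_orbit (hs₁ : 1 < s₁) (hs₂ : 1 < s₂) (hp : 0 < p) (hq : 0 < q)
    (hr : 0 < r) (hσ : 1 ≤ (s₁ - 1) * (s₂ - 1)) (n : ℕ) :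
    ∀ᶠ a in 𝓝[>] (0 : ℝ), rightHalf ((wLike (s₁ + p * a) (s₂ + q * a) (1 / 2 + r * a))^[n + 1]
      (1 / 2 + r * a)) = 0 := by
  obtain ⟨v, hv, -, hu, -⟩ := tendsto_orbit hs₁ hs₂ hp hq hr hσ n
  have hvneg : v < 0 := hv.trans_lt (neg_neg_of_pos (div_pos hr (by linarith)))
  filter_upwards [hu.eventually (gt_mem_nhds hvneg), self_mem_nhdsWithin] with a ha ha0
  rw [div_lt_iff₀ ha0, zero_mul] at ha
  simp only [rightHalf]
  rw [if_neg (by linarith)]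

lemma tendsto_orbit_half (hs₁ : 1 < s₁) (hs₂ : 1 < s₂) (hp : 0 < p) (hq : 0 < q)
    (hr : 0 < r) (hσ : 1 ≤ (s₁ - 1) * (s₂ - 1)) (n : ℕ) :
    Tendsto (fun a => (wLike (s₁ + p * a) (s₂ + q * a) (1 / 2 + r * a))^[n] (1 / 2 + r * a))
      (𝓝[>] 0) (𝓝 (1 / 2)) := by
  cases n with
  | zero => exact tendsto_affine _ _ _ nhdsWithin_le_nhds
  | succ n =>
    obtain ⟨v, -, -, hu, -⟩ := tendsto_orbit hs₁ hs₂ hp hq hr hσ n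
    have := (tendsto_zero_of_tendsto_div hu).add_const (1 / 2)
    rw [zero_add] at this
    exact this.congr fun a => sub_add_cancel _ _

/-- The unnormalized limit functional: integration against the step density of the unperturbed
map. -/
noncomputable def stepIntegral (s₁ s₂ : ℝ) (ψ : ℝ → ℝ) : ℝ :=
  (∫ x in (0 : ℝ)..1, ψ x) +
    (1 / s₁ + 1 / s₂) * (1 / 2 / (1 / 2 - 1 / 2 / s₁)) * ∫ x in (0 : ℝ)..(1 / 2), ψ x

lemma stepIntegral_one_pos (hs₁ : 1 < s₁) (hs₂ : 1 < s₂) :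
    0 < stepIntegral s₁ s₂ fun _ => 1 := by
  have : 0 < 1 / 2 - 1 / 2 / s₁ := by
    rw [sub_pos, div_lt_iff₀ (by linarith)]; linarith
  have : 0 < 1 / s₁ + 1 / s₂ := by positivity
  simp only [stepIntegral, intervalIntegral.integral_const, smul_eq_mul]
  positivity

/-- The integral with respect to the absolutely continuous invariant measure of the unperturbed
map. -/
lemma stepIntegral_eq (hs₁ : 1 < s₁) (hs₂ : 1 < s₂) {ρ C : ℝ} (H : WAdmissible ρ s₁ s₂ (1 / 2))
    {μ : ProbabilityMeasure ℝ} (hμ : IsACIM (wLike s₁ s₂ (1 / 2)) μ) {ψ : ℝ → ℝ}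
    (hψ : BddMeasurable C ψ) :
    stepIntegral s₁ s₂ ψ = stepIntegral s₁ s₂ (fun _ => 1) * ∫ x, ψ x ∂(μ : Measure ℝ) := by
  have hlt : (1 / 2 : ℝ) < 1 / 2 + 1 / 2 / s₂ := by
    have : 0 < 1 / 2 / s₂ := by positivity
    linarith
  have hfix : wLike s₁ s₂ (1 / 2) (1 / 2) = 1 / 2 := by
    rw [H.wLike_of_right le_rfl hlt]; ring
  have hit : ∀ n, (wLike s₁ s₂ (1 / 2))^[n] (1 / 2) = 1 / 2 := fun n =>
    Function.iterate_fixed hfix n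
  have hw : ∀ n, orbitWeight s₁ s₂ (1 / 2) (1 / 2) n = (-(1 / s₂)) ^ n := fun n => by
    simp only [orbitWeight, hit, H.wLikeInvSlope_of_right le_rfl hlt, Finset.prod_const,
      Finset.card_range]
  have hi : 1 / s₂ < 1 := by rw [div_lt_one] <;> linarith
  have hi0 : 0 < 1 / s₂ := by positivity
  have hR : rightSum s₁ s₂ (1 / 2) (1 / 2) = (1 + 1 / s₂)⁻¹ := by
    simp only [rightSum, hit, hw, rightHalf, le_refl, if_true, mul_one]
    rw [tsum_geometric_of_abs_lt_one (by rw [abs_neg, abs_of_pos hi0]; exact hi), sub_neg_eq_add]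
  -- At `a = 0` the peak is fixed and all weights come from the right branch. This constant is not
  -- the limit of the constants for `a → 0⁺`, but only its being nonzero matters.
  have hA : densityConst s₁ s₂ (1 / 2) ≠ 0 := by
    have : densityConst s₁ s₂ (1 / 2) = (1 - 1 / s₁) * (1 + 1 / s₂)⁻¹ := by
      unfold densityConst
      rw [hR]
      have : 1 + 1 / s₂ ≠ 0 := by positivity
      field_simp
      ring
    rw [this]
    have h1 : 1 / s₁ < 1 := by rw [div_lt_one] <;> linarith
    exact mul_ne_zero (by linarith) (by positivity)
  have key : ∀ {C : ℝ} {ψ : ℝ → ℝ}, BddMeasurable C ψ →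
      densityIntegral s₁ s₂ (1 / 2) ψ = densityConst s₁ s₂ (1 / 2) * stepIntegral s₁ s₂ ψ := by
    intro C ψ hψ
    rw [H.densityIntegral_eq_add hψ]
    simp only [hit, sub_self, mul_zero, tsum_zero, add_zero]
    rfl
  have e := H.densityIntegral_eq hμ hψ
  rw [key hψ, key BddMeasurable.one, mul_assoc] at e
  exact mul_left_cancel₀ hA e

lemma tendsto_stepFactor (hs₁ : 1 < s₁) (hs₂ : 1 < s₂) (ψ : ℝ → ℝ) :
    Tendsto (fun a => (∫ x in (0 : ℝ)..1, ψ x) + (1 / (s₁ + p * a) + 1 / (s₂ + q * a)) *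
        ((1 / 2 + r * a) / (1 / 2 - (1 / 2 + r * a) / (s₁ + p * a))) *
        ∫ x in (0 : ℝ)..(1 / 2), ψ x) (𝓝[>] 0) (𝓝 (stepIntegral s₁ s₂ ψ)) := by
  have hl : 𝓝[>] (0 : ℝ) ≤ 𝓝 0 := nhdsWithin_le_nhds
  have t1 := tendsto_affine s₁ p _ hl
  have th := tendsto_affine (1 / 2) r _ hl
  have hs1' : s₁ ≠ 0 := by linarith
  have hs2' : s₂ ≠ 0 := by linarith
  have : 1 / 2 - 1 / 2 / s₁ ≠ 0 := by
    refine ne_of_gt ?_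
    rw [sub_pos, div_lt_iff₀ (by linarith)]; linarith
  have hθ := (tendsto_one_div_affine hs1' p _ hl).add (tendsto_one_div_affine hs2' q _ hl)
  exact ((hθ.mul (th.div ((th.div t1 hs1').const_sub _) this)).mul_const _).const_add _

lemma BddMeasurable.tendsto_primitive {C x : ℝ} {ψ : ℝ → ℝ} (hψ : BddMeasurable C ψ) :
    Tendsto (fun t => (∫ y in (0 : ℝ)..t, ψ y) - ∫ y in (0 : ℝ)..x, ψ y) (𝓝 x) (𝓝 0) := by
  have := (intervalIntegral.continuous_primitive (fun a b => hψ.intervalIntegrable a b) 0).tendsto x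
  simpa using this.sub_const (∫ y in (0 : ℝ)..x, ψ y)

/-- Each later orbit point is eventually left of `1/2`, so only the index `0` contributes to
`rightSum` in the limit. -/
lemma tendsto_densityConst (hs₁ : 1 < s₁) (hs₂ : 1 < s₂) (hp : 0 < p) (hq : 0 < q)
    (hr : 0 < r) (hσ : 1 ≤ (s₁ - 1) * (s₂ - 1)) :
    Tendsto (fun a => densityConst (s₁ + p * a) (s₂ + q * a) (1 / 2 + r * a)) (𝓝[>] 0)
      (𝓝 (1 - (1 / s₁ + 1 / s₂))) := by
  have hl : 𝓝[>] (0 : ℝ) ≤ 𝓝 0 := nhdsWithin_le_nhds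
  have hadm := (eventually_wAdmissible hs₁ hs₂ hp hq hr).filter_mono
    (nhdsWithin_mono 0 Ioi_subset_Ici_self)
  -- The rate `familyRate s₁ s₂` does not depend on `a`, so a single admissible parameter supplies
  -- the summable majorant.
  obtain ⟨a₀, H₀⟩ := hadm.exists
  have hθ := (tendsto_one_div_affine (by linarith : s₁ ≠ 0) p _ hl).add
    (tendsto_one_div_affine (by linarith : s₂ ≠ 0) q _ hl)
  have hsum : Tendsto (fun a => ∑' n, orbitWeight (s₁ + p * a) (s₂ + q * a) (1 / 2 + r * a)
      (1 / 2 + r * a) (n + 1) * rightHalf ((wLike (s₁ + p * a) (s₂ + q * a)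
        (1 / 2 + r * a))^[n + 1] (1 / 2 + r * a))) (𝓝[>] 0) (𝓝 (∑' _ : ℕ, (0 : ℝ))) := by
    refine tendsto_tsum_of_dominated_convergence H₀.summable_rate (fun n => ?_) ?_
    · refine tendsto_const_nhds.congr' ?_
      filter_upwards [eventually_rightHalf_orbit hs₁ hs₂ hp hq hr hσ n] with a ha
      rw [ha, mul_zero]
    · filter_upwards [hadm] with a H n
      rw [norm_mul]
      refine (mul_le_of_le_one_right (norm_nonneg _) (WAdmissible.abs_rightHalf_le _)).trans ?_
      exact (H.abs_weight_le _ _).trans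
        (pow_le_pow_of_le_one H.rate_nonneg H.rate_lt.le (Nat.le_succ n))
  rw [tsum_zero] at hsum
  have := (hθ.mul (hsum.const_add 1)).const_sub 1
  rw [add_zero, mul_one] at this
  refine this.congr' ?_
  filter_upwards [hadm] with a H
  rw [densityConst, H.rightSum_eq_one_add]

lemma tendsto_densityIntegral (hs₁ : 1 < s₁) (hs₂ : 1 < s₂) (hp : 0 < p) (hq : 0 < q)
    (hr : 0 < r) (hσ : 1 ≤ (s₁ - 1) * (s₂ - 1)) {C : ℝ} {ψ : ℝ → ℝ} (hψ : BddMeasurable C ψ) :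
    Tendsto (fun a => densityIntegral (s₁ + p * a) (s₂ + q * a) (1 / 2 + r * a) ψ) (𝓝[>] 0)
      (𝓝 ((1 - (1 / s₁ + 1 / s₂)) * stepIntegral s₁ s₂ ψ)) := by
  have hl : 𝓝[>] (0 : ℝ) ≤ 𝓝 0 := nhdsWithin_le_nhds
  have hadm := (eventually_wAdmissible hs₁ hs₂ hp hq hr).filter_mono
    (nhdsWithin_mono 0 Ioi_subset_Ici_self)
  obtain ⟨a₀, H₀⟩ := hadm.exists
  have hθ := (tendsto_one_div_affine (by linarith : s₁ ≠ 0) p _ hl).add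
    (tendsto_one_div_affine (by linarith : s₂ ≠ 0) q _ hl)
  have hb : ∀ t ∈ Icc (0 : ℝ) 1,
      |(∫ x in (0 : ℝ)..t, ψ x) - ∫ x in (0 : ℝ)..(1 / 2), ψ x| ≤ C := by
    intro t ht
    rw [hψ.primitive_sub]
    refine (hψ.abs_integral_le _ _).trans (mul_le_of_le_one_right hψ.nonneg ?_)
    rw [abs_le]
    constructor <;> linarith [ht.1, ht.2]
  have hsum : Tendsto (fun a => ∑' n, orbitWeight (s₁ + p * a) (s₂ + q * a) (1 / 2 + r * a)
      (1 / 2 + r * a) n * ((∫ x in (0 : ℝ)..(wLike (s₁ + p * a) (s₂ + q * a)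
        (1 / 2 + r * a))^[n] (1 / 2 + r * a), ψ x) - ∫ x in (0 : ℝ)..(1 / 2), ψ x))
      (𝓝[>] 0) (𝓝 (∑' _ : ℕ, (0 : ℝ))) := by
    refine tendsto_tsum_of_dominated_convergence (H₀.summable_rate.mul_right C) (fun n => ?_) ?_
    · have := hψ.tendsto_primitive.comp (tendsto_orbit_half hs₁ hs₂ hp hq hr hσ n)
      refine bdd_le_mul_tendsto_zero' 1 ?_ this
      filter_upwards [hadm] with a H
      exact (H.abs_weight_le _ n).trans (pow_le_one₀ H.rate_nonneg H.rate_lt.le)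
    · filter_upwards [hadm] with a H n
      rw [norm_mul]
      exact mul_le_mul (H.abs_weight_le _ n) (hb _ (H.iterate_mem H.peak_mem n)) (norm_nonneg _)
        (pow_nonneg H.rate_nonneg n)
  rw [tsum_zero] at hsum
  have := ((tendsto_densityConst hs₁ hs₂ hp hq hr hσ).mul
    (tendsto_stepFactor (p := p) (q := q) (r := r) hs₁ hs₂ ψ)).add (hθ.mul hsum)
  rw [mul_zero, add_zero] at this
  refine this.congr' ?_
  filter_upwards [hadm] with a H
  rw [H.densityIntegral_eq_add hψ]

end family

/-! ### The critical case: everything to first order in `a`. -/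

section critical

variable {s₁ s₂ p q r : ℝ}

/-- The orbit bounds in the critical case, where all quantities are of the order of `a`. -/
lemma eventually_weight_bounds (hs₁ : 1 < s₁) (hs₂ : 1 < s₂) (hp : 0 < p) (hq : 0 < q)
    (hr : 0 < r) (hσ : (s₁ - 1) * (s₂ - 1) = 1) :
    ∃ K : ℝ, 0 ≤ K ∧ ∀ᶠ a in 𝓝[>] (0 : ℝ), ∀ n,
      |orbitWeight (s₁ + p * a) (s₂ + q * a) (1 / 2 + r * a) (1 / 2 + r * a) (n + 1)| *
        rightHalf ((wLike (s₁ + p * a) (s₂ + q * a) (1 / 2 + r * a))^[n + 1] (1 / 2 + r * a)) ≤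
          K * a * √(familyRate s₁ s₂) ^ n ∧
      |orbitWeight (s₁ + p * a) (s₂ + q * a) (1 / 2 + r * a) (1 / 2 + r * a) (n + 1)| *
        |(wLike (s₁ + p * a) (s₂ + q * a) (1 / 2 + r * a))^[n + 1] (1 / 2 + r * a) - 1 / 2| ≤
          2 * (K * a) * √(familyRate s₁ s₂) ^ n := by
  have hl : 𝓝[>] (0 : ℝ) ≤ 𝓝 0 := nhdsWithin_le_nhds
  have hadm := (eventually_wAdmissible hs₁ hs₂ hp hq hr).filter_mono
    (nhdsWithin_mono 0 Ioi_subset_Ici_self)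
  have t1 := tendsto_affine s₁ p _ hl
  have t2 := tendsto_affine s₂ q _ hl
  have th := tendsto_affine (1 / 2) r _ hl
  have ta : Tendsto (fun a : ℝ => r * a) (𝓝[>] 0) (𝓝 0) := by
    simpa using tendsto_affine 0 r _ hl
  have hs1' : s₁ ≠ 0 := by linarith
  have hs2' : s₂ ≠ 0 := by linarith
  have hs1 : 0 < s₁ - 1 := by linarith
  -- Half of `1/(2 s₁)`, the limiting length of the increasing inner branch's interval, so the shift
  -- `ε/(σ₁-1)` still fits.
  set η : ℝ := 1 / (4 * s₁) with hη
  have hηpos : 0 < η := by positivity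
  -- the coefficient of `a ^ 2` in the distance of the orbit from the repelling fixed point
  set k : ℝ → ℝ := fun a => r * (p * (s₂ - 1) + q * (s₁ - 1) + p * q * a) / (s₁ + p * a - 1) with hk
  have hkl : Tendsto k (𝓝[>] 0) (𝓝 (r * (p * (s₂ - 1) + q * (s₁ - 1)) / (s₁ - 1))) :=
    ((tendsto_affine _ (p * q) _ hl).const_mul r).div (t1.sub_const 1) hs1.ne'
  set k₀ : ℝ := r * (p * (s₂ - 1) + q * (s₁ - 1)) / (s₁ - 1) + 1 with hk₀
  have hk₀pos : 0 < k₀ := by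
    have : 0 < s₂ - 1 := by linarith
    positivity
  have tq : Tendsto (fun a => r * a / (s₁ + p * a - 1)) (𝓝[>] 0) (𝓝 0) := by
    have := ta.div (t1.sub_const 1) hs1.ne'
    rw [zero_div] at this
    exact this
  have ev1 : ∀ᶠ a in 𝓝[>] (0 : ℝ), r * a < (1 / 2 + r * a) / (s₂ + q * a) :=
    ta.eventually_lt (th.div t2 hs2') (by positivity)
  have ev2 : ∀ᶠ a in 𝓝[>] (0 : ℝ), r * a / (s₁ + p * a - 1) + η < (1 / 2 + r * a) / (s₁ + p * a) := by
    refine (tq.add_const η).eventually_lt (th.div t1 hs1') ?_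
    rw [zero_add, hη, div_div, div_lt_div_iff₀ (by positivity) (by positivity)]
    linarith
  have ev3 := hkl.eventually (gt_mem_nhds (show _ < k₀ by rw [hk₀]; linarith))
  have ev4 : ∀ᶠ a in 𝓝[>] (0 : ℝ), k₀ * a ^ 2 < η := by
    have : Tendsto (fun a : ℝ => k₀ * a ^ 2) (𝓝[>] 0) (𝓝 0) :=
      ((show Continuous fun a : ℝ => k₀ * a ^ 2 by fun_prop).tendsto' 0 0 (by simp)).mono_left hl
    exact this.eventually (gt_mem_nhds hηpos)
  have ev5 := t1.eventually (gt_mem_nhds (show s₁ < s₁ + 1 by linarith))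
  -- One summand for each of the three lower bounds on `M` required by `weight_bounds`, with `M = K
  -- * a` and `δ ≤ k₀ * a ^ 2`.
  set K : ℝ := r / (s₁ - 1) + √(η * k₀) + √((s₁ + 1) * k₀ / η) with hK
  have hK0 : 0 ≤ K := by positivity
  refine ⟨K, hK0, ?_⟩
  filter_upwards [hadm, ev1, ev2, ev3, ev4, ev5, self_mem_nhdsWithin] with a H e1 e2 e3 e4 e5 ha n
  have ha0 : 0 < a := ha
  have hpa : 0 < p * a := mul_pos hp ha0
  have hqa : 0 < q * a := mul_pos hq ha0
  have hd : 0 < s₁ + p * a - 1 := by linarith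
  have hs2 : 0 < s₂ - 1 := by linarith
  have hkpos : 0 < k a := by
    simp only [hk]; positivity
  have hδ : k a * a ^ 2 = r * a * ((s₁ + p * a) * (s₂ + q * a) - (s₁ + p * a) - (s₂ + q * a)) /
      (s₁ + p * a - 1) := by
    simp only [hk]
    rw [div_mul_eq_mul_div]
    congr 1
    linear_combination -(r * a) * hσ
  have hsqle : k a * a ^ 2 ≤ k₀ * a ^ 2 := mul_le_mul_of_nonneg_right e3.le (sq_nonneg a)
  have hKa : 0 ≤ K * a := by positivity
  have hle : ∀ {y x : ℝ}, 0 ≤ y → √y ≤ K → x ≤ y * a ^ 2 → x ≤ (K * a) ^ 2 := by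
    intro y x hy hyK hx
    refine hx.trans ?_
    rw [mul_pow]
    refine mul_le_mul_of_nonneg_right ?_ (sq_nonneg a)
    rw [← Real.sq_sqrt hy]
    exact pow_le_pow_left₀ (Real.sqrt_nonneg _) hyK 2
  have n1 : 0 ≤ r / (s₁ - 1) := by positivity
  have n2 := Real.sqrt_nonneg (η * k₀)
  have n3 := Real.sqrt_nonneg ((s₁ + 1) * k₀ / η)
  refine H.weight_bounds rfl (mul_pos hr ha0) e1 hδ (by positivity) hηpos
    (hsqle.trans e4.le) e2.le hKa ?_ ?_ ?_ n
  · calc r * a / (s₁ + p * a - 1) ≤ r * a / (s₁ - 1) :=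
        div_le_div_of_nonneg_left (by positivity) hs1 (by linarith)
      _ = r / (s₁ - 1) * a := by ring
      _ ≤ K * a := mul_le_mul_of_nonneg_right (by linarith) ha0.le
  · refine hle (y := η * k₀) (by positivity) (by linarith) ?_
    rw [mul_assoc]
    exact mul_le_mul_of_nonneg_left hsqle hηpos.le
  · refine hle (y := (s₁ + 1) * k₀ / η) (by positivity) (by linarith) ?_
    calc (s₁ + p * a) * (k a * a ^ 2) / η ≤ (s₁ + 1) * (k₀ * a ^ 2) / η :=
        div_le_div_of_nonneg_right (mul_le_mul e5.le hsqle (by positivity) (by linarith)) hηpos.le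
      _ = (s₁ + 1) * k₀ / η * a ^ 2 := by ring

lemma inv_add_inv_eq_one (hs₁ : 1 < s₁) (hs₂ : 1 < s₂) (hσ : (s₁ - 1) * (s₂ - 1) = 1) :
    1 / s₁ + 1 / s₂ = 1 := by
  have hs1' : s₁ ≠ 0 := by linarith
  have hs2' : s₂ ≠ 0 := by linarith
  field_simp
  linarith

lemma familyRate_lt_one (hs₁ : 1 < s₁) (hs₂ : 1 < s₂) : familyRate s₁ s₂ < 1 := by
  refine max_lt (by norm_num) (max_lt ?_ ?_)
  · rw [div_lt_one] <;> linarith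
  · rw [div_lt_one] <;> linarith

lemma summable_sqrt_familyRate (hs₁ : 1 < s₁) (hs₂ : 1 < s₂) :
    Summable fun n : ℕ => √(familyRate s₁ s₂) ^ n := by
  refine summable_geometric_of_lt_one (Real.sqrt_nonneg _) ?_
  rw [Real.sqrt_lt' one_pos, one_pow]
  exact familyRate_lt_one hs₁ hs₂

/-- Criticality kills the zeroth-order part of `1 - θ`, leaving the variation of the reciprocal
slopes. The correction to `rightSum` vanishes termwise and, being dominated by `a` times a summable
sequence, is `o(a)`. -/
lemma tendsto_densityConst_div (hs₁ : 1 < s₁) (hs₂ : 1 < s₂) (hp : 0 < p) (hq : 0 < q)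
    (hr : 0 < r) (hσ : (s₁ - 1) * (s₂ - 1) = 1) :
    Tendsto (fun a => densityConst (s₁ + p * a) (s₂ + q * a) (1 / 2 + r * a) / a) (𝓝[>] 0)
      (𝓝 ((q * s₁ + p * s₂ - p - q) / (s₁ * s₂))) := by
  have hl : 𝓝[>] (0 : ℝ) ≤ 𝓝 0 := nhdsWithin_le_nhds
  have hadm := (eventually_wAdmissible hs₁ hs₂ hp hq hr).filter_mono
    (nhdsWithin_mono 0 Ioi_subset_Ici_self)
  obtain ⟨K, hK0, hK⟩ := eventually_weight_bounds hs₁ hs₂ hp hq hr hσ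
  have hs1' : s₁ ≠ 0 := by linarith
  have hs2' : s₂ ≠ 0 := by linarith
  have i1 := tendsto_one_div_affine hs1' p _ hl
  have i2 := tendsto_one_div_affine hs2' q _ hl
  have hθ0 := inv_add_inv_eq_one hs₁ hs₂ hσ
  have hsum : Tendsto (fun a => ∑' n, orbitWeight (s₁ + p * a) (s₂ + q * a) (1 / 2 + r * a)
      (1 / 2 + r * a) (n + 1) * rightHalf ((wLike (s₁ + p * a) (s₂ + q * a)
        (1 / 2 + r * a))^[n + 1] (1 / 2 + r * a)) / a) (𝓝[>] 0) (𝓝 (∑' _ : ℕ, (0 : ℝ))) := by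
    refine tendsto_tsum_of_dominated_convergence
      ((summable_sqrt_familyRate hs₁ hs₂).mul_left K) (fun n => ?_) ?_
    · refine tendsto_const_nhds.congr' ?_
      filter_upwards [eventually_rightHalf_orbit hs₁ hs₂ hp hq hr hσ.ge n] with a ha
      rw [ha, mul_zero, zero_div]
    · filter_upwards [hK, self_mem_nhdsWithin] with a ha ha0 n
      have ha0 : 0 < a := ha0
      rw [norm_div, norm_mul, Real.norm_of_nonneg ha0.le, div_le_iff₀ ha0]
      refine le_trans (le_of_eq ?_) ((ha n).1.trans (le_of_eq (by ring)))
      congr 1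
      refine Real.norm_of_nonneg ?_
      unfold rightHalf; split_ifs <;> norm_num
  rw [tsum_zero] at hsum
  have lim := ((i1.const_mul (p / s₁)).add (i2.const_mul (q / s₂))).sub ((i1.add i2).mul hsum)
  have hval : p / s₁ * (1 / s₁) + q / s₂ * (1 / s₂) - (1 / s₁ + 1 / s₂) * 0 =
      (q * s₁ + p * s₂ - p - q) / (s₁ * s₂) := by
    have hθ1 : s₁ * s₂ = s₁ + s₂ := by linarith
    field_simp
    linear_combination -(p * s₂ + q * s₁) * hθ1
  rw [hval] at lim
  refine lim.congr' ?_
  filter_upwards [hadm, self_mem_nhdsWithin] with a H ha0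
  have ha : a ≠ 0 := ne_of_gt ha0
  have p1 : s₁ + p * a ≠ 0 := H.pos₁.ne'
  have p2 : s₂ + q * a ≠ 0 := H.pos₂.ne'
  have e : 1 - (1 / (s₁ + p * a) + 1 / (s₂ + q * a)) =
      a * (p / s₁ * (1 / (s₁ + p * a)) + q / s₂ * (1 / (s₂ + q * a))) := by
    have k1 : 1 / s₁ - 1 / (s₁ + p * a) = a * (p / s₁ * (1 / (s₁ + p * a))) := by field_simp; ring
    have k2 : 1 / s₂ - 1 / (s₂ + q * a) = a * (q / s₂ * (1 / (s₂ + q * a))) := by field_simp; ring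
    linarith
  rw [densityConst, H.rightSum_eq_one_add, tsum_div_const, mul_add, mul_one, ← sub_sub, e, sub_div,
    mul_div_cancel_left₀ _ ha, mul_div_assoc]

lemma BddMeasurable.tendsto_slope {C x v : ℝ} {ψ : ℝ → ℝ} (hψ : BddMeasurable C ψ)
    (hc : Continuous ψ) {t : ℝ → ℝ} (ht : Tendsto (fun a => (t a - x) / a) (𝓝[>] 0) (𝓝 v)) :
    Tendsto (fun a => ((∫ y in (0 : ℝ)..t a, ψ y) - ∫ y in (0 : ℝ)..x, ψ y) / a) (𝓝[>] 0)
      (𝓝 (v * ψ x)) := by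
  set I : ℝ → ℝ := fun t => ∫ y in (0 : ℝ)..t, ψ y with hI
  have hder : HasDerivAt I (ψ x) x := intervalIntegral.integral_hasDerivAt_right
    (hψ.intervalIntegrable _ _) (hc.stronglyMeasurableAtFilter _ _) hc.continuousAt
  -- The continuous extension of the difference quotient also covers parameters with `t a = x`.
  have hcont := continuousAt_dslope_same.2 hder.differentiableAt
  have htx : Tendsto t (𝓝[>] 0) (𝓝 x) := by
    have := (tendsto_zero_of_tendsto_div ht).add_const x
    rw [zero_add] at this
    exact this.congr fun a => sub_add_cancel _ _
  have h1 := hcont.tendsto.comp htx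
  rw [dslope_same, hder.deriv] at h1
  refine (ht.mul h1).congr fun a => ?_
  have := sub_smul_dslope I x (t a)
  rw [smul_eq_mul] at this
  rw [Function.comp_apply, div_mul_eq_mul_div, this]

/-- By criticality the orbit points after the peak all have first-order displacement `-r/(s₁-1)`,
with limiting weights `-(1/s₂) s₁⁻ⁿ`. The peak contributes `r`, the rest sums to `r/(s₁-1)`, in
total `r s₂` because `s₂ = s₁/(s₁-1)`. -/
lemma tendsto_densityIntegral_div (hs₁ : 1 < s₁) (hs₂ : 1 < s₂) (hp : 0 < p) (hq : 0 < q)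
    (hr : 0 < r) (hσ : (s₁ - 1) * (s₂ - 1) = 1) {C : ℝ} {ψ : ℝ → ℝ} (hψ : BddMeasurable C ψ)
    (hc : Continuous ψ) :
    Tendsto (fun a => densityIntegral (s₁ + p * a) (s₂ + q * a) (1 / 2 + r * a) ψ / a) (𝓝[>] 0)
      (𝓝 ((q * s₁ + p * s₂ - p - q) / (s₁ * s₂) * stepIntegral s₁ s₂ ψ +
        r * s₂ * ψ (1 / 2))) := by
  have hl : 𝓝[>] (0 : ℝ) ≤ 𝓝 0 := nhdsWithin_le_nhds
  have hadm := (eventually_wAdmissible hs₁ hs₂ hp hq hr).filter_mono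
    (nhdsWithin_mono 0 Ioi_subset_Ici_self)
  obtain ⟨K, hK0, hK⟩ := eventually_weight_bounds hs₁ hs₂ hp hq hr hσ
  have hs1' : s₁ ≠ 0 := by linarith
  have hs2' : s₂ ≠ 0 := by linarith
  have hs1 : s₁ - 1 ≠ 0 := by linarith
  have hθ := (tendsto_one_div_affine hs1' p _ hl).add (tendsto_one_div_affine hs2' q _ hl)
  rw [inv_add_inv_eq_one hs₁ hs₂ hσ] at hθ
  set F : ℝ → ℕ → ℝ := fun a n => orbitWeight (s₁ + p * a) (s₂ + q * a) (1 / 2 + r * a)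
      (1 / 2 + r * a) n * ((∫ x in (0 : ℝ)..(wLike (s₁ + p * a) (s₂ + q * a)
        (1 / 2 + r * a))^[n] (1 / 2 + r * a), ψ x) - ∫ x in (0 : ℝ)..(1 / 2), ψ x) with hF
  have hzero : Tendsto (fun a => F a 0 / a) (𝓝[>] 0) (𝓝 (r * ψ (1 / 2))) := by
    have : Tendsto (fun a : ℝ => (1 / 2 + r * a - 1 / 2) / a) (𝓝[>] 0) (𝓝 r) := by
      refine tendsto_const_nhds.congr' ?_
      filter_upwards [self_mem_nhdsWithin] with a ha
      have : a ≠ 0 := ne_of_gt ha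
      field_simp
      ring
    simpa only [hF, orbitWeight_zero, one_mul, Function.iterate_zero, id] using
      hψ.tendsto_slope hc this
  have hsum : Tendsto (fun a => ∑' n, F a (n + 1) / a) (𝓝[>] 0)
      (𝓝 (∑' n : ℕ, -(1 / s₂ * (1 / s₁) ^ n) * (-(r / (s₁ - 1)) * ψ (1 / 2)))) := by
    refine tendsto_tsum_of_dominated_convergence
      ((summable_sqrt_familyRate hs₁ hs₂).mul_left (C * (2 * K))) (fun n => ?_) ?_
    · obtain ⟨v, -, hv, hu, hw⟩ := tendsto_orbit hs₁ hs₂ hp hq hr hσ.ge n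
      rw [hv hσ] at hu
      simpa only [hF, mul_div_assoc] using hw.mul (hψ.tendsto_slope hc hu)
    · filter_upwards [hK, self_mem_nhdsWithin] with a ha ha0 n
      have ha0 : 0 < a := ha0
      rw [norm_div, Real.norm_of_nonneg ha0.le, div_le_iff₀ ha0, hF, norm_mul, Real.norm_eq_abs,
        Real.norm_eq_abs, hψ.primitive_sub]
      calc _ ≤ |orbitWeight (s₁ + p * a) (s₂ + q * a) (1 / 2 + r * a) (1 / 2 + r * a) (n + 1)| *
            (C * |(wLike (s₁ + p * a) (s₂ + q * a) (1 / 2 + r * a))^[n + 1] (1 / 2 + r * a) -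
              1 / 2|) := mul_le_mul_of_nonneg_left (hψ.abs_integral_le _ _) (abs_nonneg _)
        _ = C * (|orbitWeight (s₁ + p * a) (s₂ + q * a) (1 / 2 + r * a) (1 / 2 + r * a) (n + 1)| *
            |(wLike (s₁ + p * a) (s₂ + q * a) (1 / 2 + r * a))^[n + 1] (1 / 2 + r * a) -
              1 / 2|) := by ring
        _ ≤ C * (2 * (K * a) * √(familyRate s₁ s₂) ^ n) :=
          mul_le_mul_of_nonneg_left (ha n).2 hψ.nonneg
        _ = _ := by ring
  have hlim := hzero.add hsum
  have hval : r * ψ (1 / 2) + ∑' n : ℕ, -(1 / s₂ * (1 / s₁) ^ n) * (-(r / (s₁ - 1)) * ψ (1 / 2)) =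
      r * s₂ * ψ (1 / 2) := by
    have h1 : 1 / s₁ < 1 := by rw [div_lt_one] <;> linarith
    rw [tsum_mul_right, tsum_neg, tsum_mul_left, tsum_geometric_of_lt_one (by positivity) h1]
    have : s₂ = s₁ / (s₁ - 1) := by rw [eq_div_iff hs1]; linarith
    rw [this]
    have : 1 - 1 / s₁ = (s₁ - 1) / s₁ := by field_simp
    rw [this]
    field_simp
    ring
  rw [hval] at hlim
  have := ((tendsto_densityConst_div hs₁ hs₂ hp hq hr hσ).mul
    (tendsto_stepFactor (p := p) (q := q) (r := r) hs₁ hs₂ ψ)).add (hθ.mul hlim)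
  rw [one_mul] at this
  refine this.congr' ?_
  filter_upwards [hadm] with a H
  have hsF : Summable (F a) := H.summable_weight_mul _ (C := C) fun n => by
    have ht := H.iterate_mem H.peak_mem n
    rw [hψ.primitive_sub]
    refine (hψ.abs_integral_le _ _).trans (mul_le_of_le_one_right hψ.nonneg ?_)
    rw [abs_le]
    constructor <;> linarith [ht.1, ht.2]
  rw [H.densityIntegral_eq_add hψ, tsum_div_const, ← add_div, ← hsF.tsum_eq_zero_add]
  ring

end critical

/-! ### Weak convergence and the three cases. -/

lemma BddMeasurable.of_boundedContinuous (φ : BoundedContinuousFunction ℝ ℝ) :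
    BddMeasurable ‖φ‖ φ :=
  ⟨φ.continuous.measurable, fun x => φ.norm_coe_le_norm x⟩

/-- A measure carried by shrinking neighbourhoods of a point converges to the Dirac measure. -/
lemma tendsto_diracProba_of_ae_mem {l : Filter ℝ} {μ : ℝ → ProbabilityMeasure ℝ} {x₀ : ℝ}
    {b c : ℝ → ℝ} (hb : Tendsto b l (𝓝 x₀)) (hc : Tendsto c l (𝓝 x₀))
    (h : ∀ᶠ a in l, ∀ᵐ x ∂(μ a : Measure ℝ), x ∈ Icc (b a) (c a)) :
    Tendsto μ l (𝓝 (diracProba x₀)) := by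
  rw [ProbabilityMeasure.tendsto_iff_forall_integral_tendsto]
  intro φ
  have hδ : ∫ x, φ x ∂(diracProba x₀ : Measure ℝ) = φ x₀ := by
    simp [diracProba]
  rw [hδ, Metric.tendsto_nhds]
  intro ε hε
  obtain ⟨δ, hδ, hφ⟩ := Metric.continuousAt_iff.1 φ.continuous.continuousAt (ε / 2) (half_pos hε)
  filter_upwards [h, hb.eventually (Ioo_mem_nhds (sub_lt_self x₀ hδ) (lt_add_of_pos_right x₀ hδ)),
    hc.eventually (Ioo_mem_nhds (sub_lt_self x₀ hδ) (lt_add_of_pos_right x₀ hδ))]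
    with a ha hba hca
  have hint := (BddMeasurable.of_boundedContinuous φ).integrable (μ a : Measure ℝ)
  have : (∫ x, φ x ∂(μ a : Measure ℝ)) - φ x₀ = ∫ x, (φ x - φ x₀) ∂(μ a : Measure ℝ) := by
    rw [integral_sub hint (integrable_const _)]; simp
  rw [Real.dist_eq, this]
  have hle : ‖∫ x, (φ x - φ x₀) ∂(μ a : Measure ℝ)‖ ≤ ε / 2 * (μ a : Measure ℝ).real univ := by
    refine norm_integral_le_of_norm_le_const ?_
    filter_upwards [ha] with x hx
    refine (hφ (x := x) ?_).le
    rw [Real.dist_eq, abs_lt]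
    constructor <;> linarith [hx.1, hx.2, hba.1, hca.2]
  rw [probReal_univ, mul_one] at hle
  exact hle.trans_lt (half_lt_self hε)

theorem theorem1 (s₁ s₂ p q r : ℝ) (hs₁ : 1 < s₁) (hs₂ : 1 < s₂)
    (hp : 0 < p) (hq : 0 < q) (hr : 0 < r) :
    (∀ᶠ a in 𝓝[≥] (0 : ℝ),
      MapsTo (wMap s₁ s₂ p q r a) (Icc 0 1) (Icc 0 1) ∧
        ∃! ν : ProbabilityMeasure ℝ, IsACIM (wMap s₁ s₂ p q r a) ν) ∧
    ∀ (μ₀ : ProbabilityMeasure ℝ) (μ : ℝ → ProbabilityMeasure ℝ),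
      IsACIM (wMap s₁ s₂ p q r 0) μ₀ →
      (∀ᶠ a in 𝓝[>] (0 : ℝ), IsACIM (wMap s₁ s₂ p q r a) (μ a)) →
      (1 / s₁ + 1 / s₂ > 1 →
        Tendsto μ (𝓝[>] 0) (𝓝 (diracProba (1 / 2 : ℝ)))) ∧
      (1 / s₁ + 1 / s₂ = 1 →
        Tendsto (fun a => (μ a).toFiniteMeasure) (𝓝[>] 0)
          (𝓝 (Real.toNNReal ((q * s₁ + p * s₂ - p - q) * (s₂ + 2) /
                ((q * s₁ + p * s₂ - p - q) * (s₂ + 2) + 2 * r * s₁ * s₂ ^ 2)) •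
                μ₀.toFiniteMeasure +
              Real.toNNReal (2 * r * s₁ * s₂ ^ 2 /
                ((q * s₁ + p * s₂ - p - q) * (s₂ + 2) + 2 * r * s₁ * s₂ ^ 2)) •
                (diracProba (1 / 2 : ℝ)).toFiniteMeasure))) ∧
      (1 / s₁ + 1 / s₂ < 1 →
        Tendsto μ (𝓝[>] 0) (𝓝 μ₀)) := by
  have hadm := eventually_wAdmissible hs₁ hs₂ hp hq hr
  have hadm' := hadm.filter_mono (nhdsWithin_mono 0 Ioi_subset_Ici_self)
  have hl : 𝓝[>] (0 : ℝ) ≤ 𝓝 0 := nhdsWithin_le_nhds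
  have hs1' : s₁ ≠ 0 := by linarith
  have hs2' : s₂ ≠ 0 := by linarith
  have hs1 : 0 < s₁ - 1 := by linarith
  have hs2 : 0 < s₂ - 1 := by linarith
  have hθ : 1 / s₁ + 1 / s₂ - 1 = (1 - (s₁ - 1) * (s₂ - 1)) / (s₁ * s₂) := by
    field_simp; ring
  have hss : 0 < s₁ * s₂ := by positivity
  refine ⟨?_, fun μ₀ μ hμ₀ hμ => ?_⟩
  · filter_upwards [hadm] with a H
    rw [wMap_eq_wLike H]
    exact ⟨H.mapsTo, H.existsUnique_isACIM⟩
  have H₀ : WAdmissible (familyRate s₁ s₂) s₁ s₂ (1 / 2) := by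
    simpa only [mul_zero, add_zero] using hadm.self_of_nhdsWithin self_mem_Ici
  have hμ₀' : IsACIM (wLike s₁ s₂ (1 / 2)) μ₀ := by
    have H₁ : WAdmissible (familyRate s₁ s₂) (s₁ + p * 0) (s₂ + q * 0) (1 / 2 + r * 0) := by
      simpa only [mul_zero, add_zero] using H₀
    rw [wMap_eq_wLike H₁] at hμ₀
    simpa only [mul_zero, add_zero] using hμ₀
  have hμ' : ∀ᶠ a in 𝓝[>] (0 : ℝ),
      WAdmissible (familyRate s₁ s₂) (s₁ + p * a) (s₂ + q * a) (1 / 2 + r * a) ∧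
      IsACIM (wLike (s₁ + p * a) (s₂ + q * a) (1 / 2 + r * a)) (μ a) := by
    filter_upwards [hadm', hμ] with a H ha
    rw [wMap_eq_wLike H] at ha
    exact ⟨H, ha⟩
  have hstep := fun φ : BoundedContinuousFunction ℝ ℝ =>
    stepIntegral_eq hs₁ hs₂ H₀ hμ₀' (BddMeasurable.of_boundedContinuous φ)
  have hpos := stepIntegral_one_pos hs₁ hs₂
  refine ⟨fun hI => ?_, fun hII => ?_, fun hIII => ?_⟩
  · have hσ : (s₁ - 1) * (s₂ - 1) < 1 := by
      have : 0 < (1 - (s₁ - 1) * (s₂ - 1)) / (s₁ * s₂) := by linarith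
      have := (div_pos_iff_of_pos_right hss).1 this
      linarith
    have t1 := tendsto_affine s₁ p _ hl
    have t2 := tendsto_affine s₂ q _ hl
    have th := tendsto_affine (1 / 2) r _ hl
    have ta : Tendsto (fun a : ℝ => r * a) (𝓝[>] 0) (𝓝 0) := by
      simpa using tendsto_affine 0 r _ hl
    have tb : Tendsto (fun a : ℝ => r * a * (s₂ + q * a - 1)) (𝓝[>] 0) (𝓝 0) := by
      simpa using ta.mul (t2.sub_const 1)
    refine tendsto_diracProba_of_ae_mem
      (b := fun a => 1 / 2 - r * a * (s₂ + q * a - 1)) (c := fun a => 1 / 2 + r * a)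
      (by simpa only [sub_zero] using tb.const_sub (1 / 2)) th ?_
    have ev1 : ∀ᶠ a in 𝓝[>] (0 : ℝ), r * a < (1 / 2 + r * a) / (s₂ + q * a) :=
      ta.eventually_lt (th.div t2 hs2') (by positivity)
    have ev2 : ∀ᶠ a in 𝓝[>] (0 : ℝ), r * a * (s₂ + q * a - 1) < (1 / 2 + r * a) / (s₁ + p * a) :=
      tb.eventually_lt (th.div t1 hs1') (by positivity)
    have ev3 := ((t1.sub_const 1).mul (t2.sub_const 1)).eventually (gt_mem_nhds hσ)
    filter_upwards [hμ', ev1, ev2, ev3, self_mem_nhdsWithin] with a ha e1 e2 e3 ha0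
    exact ha.1.measure_trap rfl (mul_pos hr ha0) e1 e2.le e3.le ha.2
  · have hσ : (s₁ - 1) * (s₂ - 1) = 1 := by
      rw [hII, sub_self, eq_comm, div_eq_zero_iff] at hθ
      rcases hθ with h | h
      · linarith
      · exact absurd h hss.ne'
    rw [FiniteMeasure.tendsto_iff_forall_integral_tendsto]
    intro φ
    -- The quantity is `q (s₁-1) + p (s₂-1)`.
    have hQ : 0 < q * s₁ + p * s₂ - p - q := by nlinarith
    set Q := q * s₁ + p * s₂ - p - q
    have hD : 0 < Q * (s₂ + 2) + 2 * r * s₁ * s₂ ^ 2 := by positivity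
    have hnum := tendsto_densityIntegral_div hs₁ hs₂ hp hq hr hσ
      (BddMeasurable.of_boundedContinuous φ) φ.continuous
    have hden := tendsto_densityIntegral_div hs₁ hs₂ hp hq hr hσ BddMeasurable.one
      continuous_const
    have hone : stepIntegral s₁ s₂ (fun _ => 1) = (s₂ + 2) / 2 := by
      simp only [stepIntegral, intervalIntegral.integral_const, smul_eq_mul]
      rw [hII]
      have : s₂ = s₁ / (s₁ - 1) := by rw [eq_div_iff hs1.ne']; linarith
      rw [this]
      have : 1 / 2 - 1 / 2 / s₁ = (s₁ - 1) / (2 * s₁) := by field_simp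
      rw [this]
      field_simp
      ring
    have hden0 : Q / (s₁ * s₂) * stepIntegral s₁ s₂ (fun _ => 1) + r * s₂ * 1 ≠ 0 := by
      positivity
    have hlim := hnum.div hden hden0
    -- Multiplying numerator and denominator by `2 s₁ s₂` gives the stated weights, since the total
    -- mass of the step functional is `(s₂+2)/2`.
    have hval : (Q / (s₁ * s₂) * stepIntegral s₁ s₂ φ + r * s₂ * φ (1 / 2)) /
        (Q / (s₁ * s₂) * stepIntegral s₁ s₂ (fun _ => 1) + r * s₂ * 1) =
        Q * (s₂ + 2) / (Q * (s₂ + 2) + 2 * r * s₁ * s₂ ^ 2) * ∫ x, φ x ∂(μ₀ : Measure ℝ) +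
        2 * r * s₁ * s₂ ^ 2 / (Q * (s₂ + 2) + 2 * r * s₁ * s₂ ^ 2) * φ (1 / 2) := by
      rw [div_eq_iff hden0, hstep φ, hone]
      field_simp
    rw [hval] at hlim
    have hint : ∫ x, φ x ∂((Real.toNNReal (Q * (s₂ + 2) /
        (Q * (s₂ + 2) + 2 * r * s₁ * s₂ ^ 2)) • μ₀.toFiniteMeasure +
        Real.toNNReal (2 * r * s₁ * s₂ ^ 2 / (Q * (s₂ + 2) + 2 * r * s₁ * s₂ ^ 2)) •
          (diracProba (1 / 2 : ℝ)).toFiniteMeasure : FiniteMeasure ℝ) : Measure ℝ) =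
        Q * (s₂ + 2) / (Q * (s₂ + 2) + 2 * r * s₁ * s₂ ^ 2) * ∫ x, φ x ∂(μ₀ : Measure ℝ) +
        2 * r * s₁ * s₂ ^ 2 / (Q * (s₂ + 2) + 2 * r * s₁ * s₂ ^ 2) * φ (1 / 2) := by
      have hφ := BddMeasurable.of_boundedContinuous φ
      have h1 : 0 ≤ Q * (s₂ + 2) / (Q * (s₂ + 2) + 2 * r * s₁ * s₂ ^ 2) := by positivity
      have h2 : 0 ≤ 2 * r * s₁ * s₂ ^ 2 / (Q * (s₂ + 2) + 2 * r * s₁ * s₂ ^ 2) := by positivity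
      have hδ : ∫ x, φ x ∂((diracProba (1 / 2 : ℝ)).toFiniteMeasure : Measure ℝ) = φ (1 / 2) := by
        change ∫ x, φ x ∂(Measure.dirac (1 / 2)) = _
        rw [integral_dirac]
      rw [FiniteMeasure.toMeasure_add, integral_add_measure (hφ.integrable _) (hφ.integrable _),
        FiniteMeasure.toMeasure_smul, FiniteMeasure.toMeasure_smul, integral_smul_nnreal_measure,
        integral_smul_nnreal_measure, NNReal.smul_def, NNReal.smul_def, Real.coe_toNNReal _ h1,
        Real.coe_toNNReal _ h2, hδ]
      rfl
    rw [hint]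
    refine hlim.congr' ?_
    -- The nonzero limit of the denominator excludes a vanishing total signed mass for small `a`, so
    -- the quotient is the integral against `μ a`.
    filter_upwards [hμ', hden.eventually_ne hden0] with a ha hne
    rw [Pi.div_apply, ha.1.densityIntegral_eq ha.2 (BddMeasurable.of_boundedContinuous φ),
      mul_div_right_comm, mul_div_cancel_left₀ _ hne]
    rfl
  · have hσ : 1 ≤ (s₁ - 1) * (s₂ - 1) := by
      have : (1 - (s₁ - 1) * (s₂ - 1)) / (s₁ * s₂) < 0 := by linarith
      by_contra hlt
      have : 0 ≤ (1 - (s₁ - 1) * (s₂ - 1)) / (s₁ * s₂) := div_nonneg (by linarith) hss.le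
      linarith
    rw [ProbabilityMeasure.tendsto_iff_forall_integral_tendsto]
    intro φ
    have hnum := tendsto_densityIntegral hs₁ hs₂ hp hq hr hσ
      (BddMeasurable.of_boundedContinuous φ)
    have hden := tendsto_densityIntegral hs₁ hs₂ hp hq hr hσ BddMeasurable.one
    have h1 : 0 < 1 - (1 / s₁ + 1 / s₂) := by linarith
    have hden0 : (1 - (1 / s₁ + 1 / s₂)) * stepIntegral s₁ s₂ (fun _ => 1) ≠ 0 := by positivity
    have hlim := hnum.div hden hden0
    rw [hstep φ, ← mul_assoc, mul_div_cancel_left₀ _ hden0] at hlim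
    refine hlim.congr' ?_
    filter_upwards [hμ', hden.eventually_ne hden0] with a ha hne
    rw [Pi.div_apply, ha.1.densityIntegral_eq ha.2 (BddMeasurable.of_boundedContinuous φ),
      mul_div_cancel_left₀ _ hne]
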